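/- Fix integers $d\ge 3$ and $k\ge 1$. For $n\ge 1$ let $(H_d(n,\mu))_{\mu=0}^{\binom nd}$ be the $d$-uniform random hypergraph process on the vertex set $[n]=\{1,\dots,n\}$: $H_d(n,0)$ has no edges, and $H_d(n,\mu+1)$ is obtained from $H_d(n,\mu)$ by inserting one edge chosen uniformly at random among the $\binom nd-\mu$ $d$-element subsets of $[n]$ that are not yet edges. The degree of a vertex is the number of edges that contain it. A hypergraph is connected if it has a vertex and any two of its vertices are joined by a finite sequence of vertices in which consecutive ones lie in a common edge; it is $k$-connected if it has more than $k$ vertices and, whenever $k-1$ vertices are deleted along with all edges incident to them, the remaining hypergraph is connected. Let $\tau_k$ be the first time $\mu$ at which every vertex of $H_d(n,\mu)$ has degree at least $k$, and let $T_k$ be the first time $\mu$ at which $H_d(n,\mu)$ is $k$-connected (each is $\infty$ if there is no such time, which can happen only for finitely many $n$). Then $$\mathbb P(\tau_k=T_k)\longrightarrow 1\qquad\text{as } n\to\infty .$$ -/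

import Mathlib

open Filter Topology
open scoped Hypergraph

namespace Hypergraph

variable {α : Type*}

/-- The degree of a vertex: the number of edges that contain it. -/
noncomputable def degree (H : Hypergraph α) (v : α) : ℕ∞ := {e ∈ E(H) | v ∈ e}.encard

/-- The minimum degree is at least `k`. -/
def MinDegreeAtLeast (k : ℕ) (H : Hypergraph α) : Prop :=
  ∀ v ∈ V(H), (k : ℕ∞) ≤ H.degree v

/-- The hypergraph left when the vertices of `S` are deleted along with their incident edges. -/
def deleteVertices (H : Hypergraph α) (S : Set α) : Hypergraph α where
  vertexSet := V(H) \ S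
  edgeSet := {e ∈ E(H) | Disjoint e S}
  subset_vertexSet_of_mem_edgeSet' := fun _ he =>
    Set.subset_sdiff.mpr ⟨H.subset_vertexSet_of_mem_edgeSet he.1, he.2⟩

/-- A hypergraph is connected if it has a vertex and any two of its vertices are joined by a
finite sequence of vertices in which consecutive ones lie in a common edge. -/
def Connected (H : Hypergraph α) : Prop :=
  V(H).Nonempty ∧ ∀ x ∈ V(H), ∀ y ∈ V(H), Relation.ReflTransGen H.Adj x y

/-- `k`-(vertex-)connectedness: there are more than `k` vertices, and whenever `k - 1` vertices are
deleted, along with their incident edges, the remaining hypergraph is connected. -/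
def KConnected (k : ℕ) (H : Hypergraph α) : Prop :=
  (k : ℕ∞) < V(H).encard ∧
    ∀ S : Set α, S ⊆ V(H) → S.encard + 1 = (k : ℕ∞) → (H.deleteVertices S).Connected

end Hypergraph

namespace RandomHypergraph

/-- The potential edges of a `d`-uniform hypergraph on `n` vertices. -/
def potentialEdges (n d : ℕ) : Finset (Finset (Fin n)) := Finset.powersetCard d Finset.univ

/-- The potential edges that have not been inserted yet, where `l` lists the inserted ones. -/
def remainingEdges (n d : ℕ) (l : List (Finset (Fin n))) : Finset (Finset (Fin n)) :=
  potentialEdges n d \ l.toFinset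

open Classical in
/-- The law of the list of the first `μ` inserted edges, in the order of insertion: each step
inserts an edge chosen uniformly at random among all remaining potential edges (and nothing happens
once no potential edge remains). -/
noncomputable def insertionLaw (n d : ℕ) : ℕ → PMF (List (Finset (Fin n)))
  | 0 => PMF.pure []
  | μ + 1 => (insertionLaw n d μ).bind fun l =>
      if h : (remainingEdges n d l).Nonempty then
        (PMF.uniformOfFinset (remainingEdges n d l) h).map fun e => l ++ [e]
      else PMF.pure l

/-- The law of the whole process, which runs until all `n.choose d` potential edges are inserted. A
sample point is the list of all potential edges in the order of insertion. -/
noncomputable def processLaw (n d : ℕ) : PMF (List (Finset (Fin n))) :=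
  insertionLaw n d (n.choose d)

/-- The random hypergraph process: at time `μ`, the hypergraph on all `n` vertices whose edges are
the first `μ` inserted ones. -/
def process (n : ℕ) (μ : ℕ) (ω : List (Finset (Fin n))) : Hypergraph (Fin n) where
  vertexSet := Set.univ
  edgeSet := {e | ∃ f ∈ ω.take μ, (f : Set (Fin n)) = e}
  subset_vertexSet_of_mem_edgeSet' := fun _ _ => Set.subset_univ _

/-- The first time at which the process has minimum degree at least `k` (`⊤` if never). -/
noncomputable def minDegreeTime (n k : ℕ) : List (Finset (Fin n)) → WithTop ℕ :=
  MeasureTheory.hittingAfter (process n) {H | H.MinDegreeAtLeast k} 0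

/-- The first time at which the process is `k`-connected (`⊤` if never). -/
noncomputable def connectivityTime (n k : ℕ) : List (Finset (Fin n)) → WithTop ℕ :=
  MeasureTheory.hittingAfter (process n) {H | H.KConnected k} 0

end RandomHypergraph

/-! The inequality `τ_k ≤ T_k` is deterministic: if some vertex has fewer than `k` edges, deleting
one further vertex from each of them, padded to `k - 1` vertices, isolates it
(`minDegreeAtLeast_of_kConnected`). The converse only has to hold with high probability, and it is
proved on a window of times `[m₁, m₂]` that contains `τ_k` with high probability.

With `L = log n`, the start is `m₁ ≈ (n / d) (L - (log L) / 2)`. There the expected number of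
isolated vertices is at least `√L / e`, and isolation events of distinct vertices are negatively
correlated, so the second moment method yields an isolated vertex (`tendsto_no_isolated`). The end
`m₂` is a large multiple of `n L`; there a union bound shows that all degrees are at least `k`
(`tendsto_lowDegreeEvent`).

Suppose that within the window the minimum degree is at least `k` but `k`-connectedness fails. Take
a separator `S` of least size `s < k`, and then a side `A` of least size `a ≤ n / 2`. Minimality
attaches to each `x ∈ S` an edge that meets `S` only in `x` and also meets `A`, and produces one
extra edge `g`: inside `A` if `a ≥ 2`, and joining the single vertex of `A` to `S` if `a = 1`. No
edge avoiding `S` meets `A` in exactly one vertex (`exists_obstruction`).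

The first moment of such configurations vanishes (`tendsto_gapEvent`). Choosing `A` and forbidding
the leaving edges until `m₁` costs at most `exp (C √L) = n ^ o(1)`, also with any fixed power of `a`
as an extra factor. The `s` attached edges contribute polylogarithmic factors times powers of `a`.
The extra edge gains a factor of about `1 / n` if `a = 1` and `a ^ 3 / n ^ 2` otherwise, up to
logarithms. Summed over `a` this is `n ^ (-1 + o(1))`. -/

namespace RandomHypergraph

open scoped ENNReal

variable {n d : ℕ}

/-! ### Probabilities of avoiding and containing prescribed edges -/

/-- The lists of `i` distinct potential edges. -/
def Admissible (n d i : ℕ) (l : List (Finset (Fin n))) : Prop :=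
  l.Nodup ∧ l.length = i ∧ ∀ e ∈ l, e ∈ potentialEdges n d

theorem card_potentialEdges (n d : ℕ) : (potentialEdges n d).card = n.choose d := by
  simp [potentialEdges]

theorem mem_potentialEdges {e : Finset (Fin n)} : e ∈ potentialEdges n d ↔ e.card = d := by
  simp [potentialEdges, Finset.mem_powersetCard]

theorem Admissible.card_remainingEdges {i : ℕ} {l : List (Finset (Fin n))}
    (h : Admissible n d i l) : (remainingEdges n d l).card = n.choose d - i := by
  have hsub : l.toFinset ⊆ potentialEdges n d := fun e he => h.2.2 e (List.mem_toFinset.1 he)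
  rw [remainingEdges, Finset.card_sdiff_of_subset hsub, card_potentialEdges,
    List.toFinset_card_of_nodup h.1, h.2.1]

theorem admissible_append {i : ℕ} {l : List (Finset (Fin n))} {e : Finset (Fin n)}
    (h : Admissible n d i l) (he : e ∈ remainingEdges n d l) :
    Admissible n d (i + 1) (l ++ [e]) := by
  rw [remainingEdges, Finset.mem_sdiff, List.mem_toFinset] at he
  refine ⟨?_, by simp [h.2.1], ?_⟩
  · rw [List.nodup_append]
    refine ⟨h.1, by simp, ?_⟩
    rintro a ha b hb rfl
    exact he.2 ((List.mem_singleton.1 hb) ▸ ha)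
  · intro f hf
    rcases List.mem_append.1 hf with hf | hf
    · exact h.2.2 f hf
    · exact (List.mem_singleton.1 hf) ▸ he.1

/-- Before all `n.choose d` steps are used up some potential edge remains, so the default branch of
the law is never taken. -/
theorem admissible_of_mem_support {μ : ℕ} (hμ : μ ≤ n.choose d) {l : List (Finset (Fin n))}
    (hl : l ∈ (insertionLaw n d μ).support) : Admissible n d μ l := by
  induction μ generalizing l with
  | zero =>
    rw [insertionLaw, PMF.mem_support_pure_iff] at hl
    subst hl
    exact ⟨List.nodup_nil, rfl, by simp⟩
  | succ μ ih =>
    rw [insertionLaw, PMF.mem_support_bind_iff] at hl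
    obtain ⟨l', hl', h⟩ := hl
    have hadm := ih (by omega) hl'
    have hne : (remainingEdges n d l').Nonempty := by
      rw [← Finset.card_pos, hadm.card_remainingEdges]; omega
    rw [dif_pos hne, PMF.mem_support_map_iff] at h
    obtain ⟨e, he, rfl⟩ := h
    rw [PMF.mem_support_uniformOfFinset_iff] at he
    exact admissible_append hadm he

/-- The lists whose entries satisfy the positionwise constraints `C`. -/
def constrained (C : ℕ → Set (Finset (Fin n))) : Set (List (Finset (Fin n))) :=
  {l | ∀ j (hj : j < l.length), l[j] ∈ C j}

theorem append_mem_constrained {C : ℕ → Set (Finset (Fin n))} {l : List (Finset (Fin n))}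
    {e : Finset (Fin n)} :
    l ++ [e] ∈ constrained C ↔ l ∈ constrained C ∧ e ∈ C l.length := by
  constructor
  · intro h
    refine ⟨fun j hj => ?_, ?_⟩
    · have := h j (by simp; omega)
      rwa [List.getElem_append_left hj] at this
    · have := h l.length (by simp)
      simpa using this
  · rintro ⟨h1, h2⟩ j hj
    rcases lt_or_ge j l.length with h | h
    · rw [List.getElem_append_left h]; exact h1 j h
    · have : j = l.length := by simp at hj; omega
      subst this
      simpa using h2

-- Conditioning on the first `μ` edges: the only new constraint concerns position `μ`, and its
-- conditional probability is the fraction of remaining edges that satisfy it.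
open Classical in
theorem insertionLaw_succ_constrained {μ : ℕ} (hμ : μ < n.choose d)
    (C : ℕ → Set (Finset (Fin n))) :
    (insertionLaw n d (μ + 1)).toOuterMeasure (constrained C) =
      ∑' l, insertionLaw n d μ l * (if l ∈ constrained C then
        (((remainingEdges n d l).filter (· ∈ C μ)).card : ℝ≥0∞) / ((n.choose d - μ : ℕ) : ℝ≥0∞)
        else 0) := by
  rw [insertionLaw, PMF.toOuterMeasure_bind_apply]
  refine tsum_congr fun l => ?_
  by_cases hl : l ∈ (insertionLaw n d μ).support
  swap
  · rw [PMF.mem_support_iff, not_not] at hl; simp [hl]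
  have hadm := admissible_of_mem_support hμ.le hl
  have hne : (remainingEdges n d l).Nonempty := by
    rw [← Finset.card_pos, hadm.card_remainingEdges]; omega
  congr 1
  rw [dif_pos hne, PMF.toOuterMeasure_map_apply, PMF.toOuterMeasure_uniformOfFinset_apply,
    hadm.card_remainingEdges]
  split_ifs with h
  · congr 3
    ext e
    simp only [Finset.mem_filter, Set.mem_preimage, append_mem_constrained, h, true_and, hadm.2.1]
  · simp only [Set.mem_preimage, append_mem_constrained, h, false_and]
    simp

-- Chain rule for conditional probabilities. The ratio bound is only needed for pasts that satisfy
-- the earlier constraints, which is how facts such as "no edge of `F` has been used" become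
-- available.
open Classical in
theorem insertionLaw_constrained_le {μ : ℕ} (hμ : μ ≤ n.choose d)
    (C : ℕ → Set (Finset (Fin n))) (r : ℕ → ℝ) (hr : ∀ i, 0 ≤ r i)
    (h : ∀ i < μ, ∀ l, Admissible n d i l → l ∈ constrained C →
      (((remainingEdges n d l).filter (· ∈ C i)).card : ℝ) ≤ r i * (n.choose d - i)) :
    (insertionLaw n d μ).toOuterMeasure (constrained C) ≤
      ENNReal.ofReal (∏ i ∈ Finset.range μ, r i) := by
  induction μ with
  | zero =>
    simp only [Finset.range_zero, Finset.prod_empty, ENNReal.ofReal_one]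
    exact (PMF.toOuterMeasure_mono _ (Set.subset_univ _)).trans_eq
      ((PMF.toOuterMeasure_apply_eq_one_iff _ _).2 (Set.subset_univ _))
  | succ μ ih =>
    rw [insertionLaw_succ_constrained (by omega), Finset.prod_range_succ,
      ENNReal.ofReal_mul (Finset.prod_nonneg fun i _ => hr i)]
    refine le_trans ?_ (mul_le_mul_left (ih (by omega) fun i hi => h i (by omega)) _)
    rw [PMF.toOuterMeasure_apply, ← ENNReal.tsum_mul_right]
    refine ENNReal.tsum_le_tsum fun l => ?_
    by_cases hl : l ∈ (insertionLaw n d μ).support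
    swap
    · rw [PMF.mem_support_iff, not_not] at hl; simp [hl]
    by_cases hc : l ∈ constrained C
    swap
    · simp [hc]
    have hadm := admissible_of_mem_support (by omega) hl
    rw [if_pos hc, Set.indicator_of_mem hc]
    gcongr
    have h1 := h μ (by omega) l hadm hc
    have hpos : (0 : ℝ) < ((n.choose d - μ : ℕ) : ℝ) := by
      exact_mod_cast (by omega : 0 < n.choose d - μ)
    rw [← Nat.cast_sub (by omega)] at h1
    rw [← ENNReal.ofReal_natCast, ← ENNReal.ofReal_natCast, ← ENNReal.ofReal_div_of_pos hpos]
    exact ENNReal.ofReal_le_ofReal ((div_le_iff₀ hpos).2 h1)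

-- The exact form of the chain rule; the second moment method needs equality, not just an upper
-- bound.
open Classical in
theorem insertionLaw_constrained_eq {μ : ℕ} (hμ : μ ≤ n.choose d)
    (C : ℕ → Set (Finset (Fin n))) (r : ℕ → ℝ) (hr : ∀ i, 0 ≤ r i)
    (h : ∀ i < μ, ∀ l, Admissible n d i l → l ∈ constrained C →
      (((remainingEdges n d l).filter (· ∈ C i)).card : ℝ) = r i * (n.choose d - i)) :
    (insertionLaw n d μ).toOuterMeasure (constrained C) =
      ENNReal.ofReal (∏ i ∈ Finset.range μ, r i) := by
  induction μ with
  | zero =>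
    simp only [Finset.range_zero, Finset.prod_empty, ENNReal.ofReal_one]
    rw [PMF.toOuterMeasure_apply_eq_one_iff, insertionLaw, PMF.support_pure,
      Set.singleton_subset_iff]
    intro j hj
    simp at hj
  | succ μ ih =>
    rw [insertionLaw_succ_constrained (by omega), Finset.prod_range_succ,
      ENNReal.ofReal_mul (Finset.prod_nonneg fun i _ => hr i),
      ← ih (by omega) fun i hi => h i (by omega), PMF.toOuterMeasure_apply,
      ← ENNReal.tsum_mul_right]
    refine tsum_congr fun l => ?_
    by_cases hl : l ∈ (insertionLaw n d μ).support
    swap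
    · rw [PMF.mem_support_iff, not_not] at hl; simp [hl]
    by_cases hc : l ∈ constrained C
    swap
    · simp [hc]
    have hadm := admissible_of_mem_support (by omega) hl
    rw [if_pos hc, Set.indicator_of_mem hc]
    congr 1
    have h1 := h μ (by omega) l hadm hc
    have hpos : (0 : ℝ) < ((n.choose d - μ : ℕ) : ℝ) := by
      exact_mod_cast (by omega : 0 < n.choose d - μ)
    rw [← Nat.cast_sub (by omega)] at h1
    rw [← ENNReal.ofReal_natCast, ← ENNReal.ofReal_natCast, ← ENNReal.ofReal_div_of_pos hpos,
      h1, mul_div_cancel_right₀ _ hpos.ne']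

/-- The number of remaining edges outside a set `F` of potential edges, none of which has been
inserted. -/
theorem card_remainingEdges_sdiff {i : ℕ} {l : List (Finset (Fin n))} (hl : Admissible n d i l)
    {F : Finset (Finset (Fin n))} (hF : F ⊆ potentialEdges n d) (hlF : ∀ e ∈ l, e ∉ F) :
    (remainingEdges n d l \ F).card = n.choose d - i - F.card := by
  rw [Finset.card_sdiff_of_subset, hl.card_remainingEdges]
  intro e he
  rw [remainingEdges, Finset.mem_sdiff, List.mem_toFinset]
  exact ⟨hF he, fun h => hlF e h he⟩

theorem card_le_of_forall_notMem {i : ℕ} {l : List (Finset (Fin n))} (hl : Admissible n d i l)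
    {F : Finset (Finset (Fin n))} (hF : F ⊆ potentialEdges n d) (hlF : ∀ e ∈ l, e ∉ F) :
    F.card ≤ n.choose d - i := by
  rw [← hl.card_remainingEdges]
  refine Finset.card_le_card fun e he => ?_
  rw [remainingEdges, Finset.mem_sdiff, List.mem_toFinset]
  exact ⟨hF he, fun h => hlF e h he⟩

theorem forall_mem_of_constrained {C : ℕ → Set (Finset (Fin n))} {l : List (Finset (Fin n))}
    (hl : l ∈ constrained C) {P : Finset (Fin n) → Prop}
    (h : ∀ j < l.length, ∀ e ∈ C j, P e) : ∀ e ∈ l, P e := by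
  intro e he
  obtain ⟨j, hj, rfl⟩ := List.mem_iff_getElem.1 he
  exact h j hj _ (hl j hj)

/-- The exact probability that the first `m` edges avoid `F`. -/
theorem processLaw_avoid {m : ℕ} (F : Finset (Finset (Fin n))) (hF : F ⊆ potentialEdges n d)
    (hm : m + F.card ≤ n.choose d) :
    (processLaw n d).toOuterMeasure {ω | ∀ e ∈ F, e ∉ ω.take m} =
      ENNReal.ofReal (∏ i ∈ Finset.range m,
        (1 - (F.card : ℝ) / ((n.choose d : ℝ) - i))) := by
  classical
  set N := n.choose d with hN
  have hr : ∀ i < m, (0 : ℝ) ≤ 1 - (F.card : ℝ) / ((N : ℝ) - i) := by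
    intro i hi
    have : ((i : ℝ) + F.card + 1) ≤ N := by exact_mod_cast (by omega : i + F.card + 1 ≤ N)
    rw [sub_nonneg, div_le_one (by linarith [Nat.cast_nonneg (α := ℝ) F.card])]
    linarith
  -- Only the first `m` positions are constrained. As long as `F` is untouched, `F.card` of the `N -
  -- i` remaining edges are forbidden.
  have key := insertionLaw_constrained_eq (n := n) (d := d) (μ := N) le_rfl
    (fun i => if i < m then {e | e ∉ F} else Set.univ)
    (fun i => if i < m then 1 - (F.card : ℝ) / ((N : ℝ) - i) else 1)
    (fun i => by
      split_ifs with h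
      · exact hr i h
      · exact zero_le_one)
    (fun i hi l hl hc => by
      have hpos : (0 : ℝ) < (N : ℝ) - i := by
        rw [sub_pos]; exact_mod_cast hi
      by_cases him : i < m
      · have hlF : ∀ e ∈ l, e ∉ F := forall_mem_of_constrained hc fun j hj e he => by
          rw [hl.2.1] at hj
          rw [if_pos (by omega)] at he
          exact he
        have := card_remainingEdges_sdiff hl hF hlF
        simp only [him, if_true, Set.mem_ofPred_eq]
        rw [Finset.filter_notMem_eq_sdiff, this, Nat.cast_sub, Nat.cast_sub hi.le]
        · rw [← hN]
          field_simp
        · omega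
      · simp only [him, if_false, Set.mem_univ, Finset.filter_true, one_mul]
        rw [hl.card_remainingEdges, Nat.cast_sub hi.le])
  rw [processLaw]
  convert key using 1
  · refine PMF.toOuterMeasure_apply_eq_of_inter_support_eq _ ?_
    ext ω
    simp only [Set.mem_inter_iff, Set.mem_ofPred_eq, and_congr_left_iff]
    intro _
    constructor
    · intro h j hj
      dsimp only
      split_ifs with hjm
      · intro hF
        exact h _ hF (List.mem_take_iff_getElem.2 ⟨j, by omega, rfl⟩)
      · trivial
    · intro h e he hmem
      obtain ⟨j, hj, rfl⟩ := List.mem_take_iff_getElem.1 hmem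
      have := h j (by omega)
      dsimp only at this
      rw [if_pos (by omega)] at this
      exact this he
  · congr 1
    rw [← Finset.prod_subset (Finset.range_subset_range.2 (by omega : m ≤ N))]
    · exact Finset.prod_congr rfl fun i hi => by rw [if_pos (Finset.mem_range.1 hi)]
    · intro i _ hi
      rw [if_neg (by simpa using hi)]

/-- `R` is the set of prescribed positions; it removes at most `R.card` of the `m₁` exponential
factors. -/
theorem placement_prod_le {N m₁ m₂ : ℕ} (h12 : m₁ ≤ m₂) (hN : m₂ ≤ N) (R : Finset ℕ)
    (hR : R ⊆ Finset.range m₂) {x y : ℝ} (hx : 0 ≤ x) (hy : 0 ≤ y) :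
    ∏ i ∈ Finset.range N, (if i ∈ R then x else if i < m₁ then Real.exp (-y) else 1) ≤
      x ^ R.card * Real.exp (-y * ((m₁ : ℝ) - R.card)) := by
  have h1 : ∀ i, (if i ∈ R then x else if i < m₁ then Real.exp (-y) else 1) =
      (if i ∈ R then x else 1) * (if i ∈ Finset.range m₁ \ R then Real.exp (-y) else 1) := by
    intro i
    by_cases h : i ∈ R <;> simp [h]
  simp only [h1]
  rw [Finset.prod_mul_distrib, Finset.prod_ite_mem, Finset.prod_ite_mem, Finset.prod_const,
    Finset.prod_const, Finset.inter_eq_right.2, Finset.inter_eq_right.2, ← Real.exp_nat_mul]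
  · refine mul_le_mul_of_nonneg_left (Real.exp_le_exp.2 ?_) (by positivity)
    have : ((m₁ : ℝ) - R.card) ≤ (Finset.range m₁ \ R).card := by
      rw [sub_le_iff_le_add]
      have := Finset.le_card_sdiff R (Finset.range m₁)
      rw [Finset.card_range] at this
      exact_mod_cast (by omega)
    nlinarith
  · exact Finset.sdiff_subset.trans (Finset.range_subset_range.2 (h12.trans hN))
  · exact hR.trans (Finset.range_subset_range.2 hN)

/-- The probability that the edges of `D` sit at prescribed positions while the first `m₁` edges
avoid `F`. -/
theorem processLaw_placement_le {m₁ m₂ : ℕ} (h12 : m₁ ≤ m₂) (hm : 2 * m₂ ≤ n.choose d)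
    (D F : Finset (Finset (Fin n))) (hF : F ⊆ potentialEdges n d) (hDF : Disjoint D F)
    (φ : D → Fin m₂) :
    (processLaw n d).toOuterMeasure
      {ω | (∀ e : D, ∃ h : (φ e : ℕ) < ω.length, ω[(φ e : ℕ)] = e) ∧ ∀ e ∈ F, e ∉ ω.take m₁} ≤
      ENNReal.ofReal ((2 / (n.choose d : ℝ)) ^ D.card *
        Real.exp (-((F.card : ℝ) / n.choose d) * ((m₁ : ℝ) - D.card))) := by
  classical
  set N := n.choose d with hN
  by_cases hφ : Function.Injective φ
  swap
  · have : {ω : List (Finset (Fin n)) | (∀ e : D, ∃ h : (φ e : ℕ) < ω.length,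
        ω[(φ e : ℕ)] = e) ∧ ∀ e ∈ F, e ∉ ω.take m₁} = ∅ := by
      refine Set.eq_empty_of_forall_notMem fun ω hω => hφ fun e e' hee => ?_
      obtain ⟨h1, h2⟩ := hω.1 e
      obtain ⟨h3, h4⟩ := hω.1 e'
      apply Subtype.ext
      rw [← h2, ← h4]
      simp only [hee]
    rw [this]
    simp
  set R : Finset ℕ := Finset.univ.image fun e : D => (φ e : ℕ) with hRdef
  have hRcard : R.card = D.card := by
    rw [hRdef, Finset.card_image_of_injective, Finset.card_univ, Fintype.card_coe]
    exact Fin.val_injective.comp hφ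
  have hRsub : R ⊆ Finset.range m₂ := by
    intro i hi
    obtain ⟨e, -, rfl⟩ := Finset.mem_image.1 hi
    exact Finset.mem_range.2 (φ e).2
  obtain ⟨C, hC⟩ : ∃ C : ℕ → Set (Finset (Fin n)), ∀ i f, f ∈ C i ↔
      (∀ e : D, (φ e : ℕ) = i → f = e) ∧ (i ∉ R → i < m₁ → f ∉ F) :=
    ⟨fun i => {f | (∀ e : D, (φ e : ℕ) = i → f = e) ∧ (i ∉ R → i < m₁ → f ∉ F)},
      fun i f => Iff.rfl⟩
  have key := insertionLaw_constrained_le (n := n) (d := d) (μ := N) le_rfl C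
    -- At a prescribed position one edge is allowed while at least `N / 2` remain, because `2 * m₂ ≤
    -- N`; this gives `2 / N`.
    (fun i => if i ∈ R then 2 / (N : ℝ) else if i < m₁ then Real.exp (-((F.card : ℝ) / N)) else 1)
    (fun i => by positivity)
    (fun i hi l hl hc => by
      have hNpos : (0 : ℝ) < N := by exact_mod_cast (by omega : 0 < N)
      have hpos : (0 : ℝ) < (N : ℝ) - i := by
        rw [sub_pos]; exact_mod_cast hi
      split_ifs with hiR him
      · obtain ⟨e, -, he⟩ := Finset.mem_image.1 hiR
        have h1 : ((remainingEdges n d l).filter (· ∈ C i)).card ≤ 1 := by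
          rw [Finset.card_le_one]
          intro a ha b hb
          rw [((hC _ _).1 (Finset.mem_filter.1 ha).2).1 e he,
            ((hC _ _).1 (Finset.mem_filter.1 hb).2).1 e he]
        have h2 : (2 * i : ℝ) ≤ N := by
          have := Finset.mem_range.1 (hRsub hiR)
          exact_mod_cast (by omega : 2 * i ≤ N)
        calc _ ≤ (1 : ℝ) := by exact_mod_cast h1
          _ ≤ 2 / (N : ℝ) * (N - i) := by
            rw [div_mul_eq_mul_div, le_div_iff₀ hNpos]
            linarith
      -- All of `F` is still available: earlier prescribed positions hold edges of `D`, which is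
      -- disjoint from `F`, and the other earlier positions avoid `F`.
      · have hlF : ∀ e ∈ l, e ∉ F := forall_mem_of_constrained hc fun j hj e he => by
          rw [hl.2.1] at hj
          rw [hC] at he
          by_cases hjR : j ∈ R
          · obtain ⟨e', -, he'⟩ := Finset.mem_image.1 hjR
            rw [he.1 e' he']
            exact Finset.disjoint_left.1 hDF e'.2
          · exact he.2 hjR (by omega)
        have h1 : (remainingEdges n d l).filter (· ∈ C i) ⊆ remainingEdges n d l \ F := by
          intro f hf
          rw [Finset.mem_filter, hC] at hf
          exact Finset.mem_sdiff.2 ⟨hf.1, hf.2.2 hiR him⟩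
        have h2 := Finset.card_le_card h1
        rw [card_remainingEdges_sdiff hl hF hlF] at h2
        have h3 := card_le_of_forall_notMem hl hF hlF
        calc _ ≤ ((n.choose d - i - F.card : ℕ) : ℝ) := by exact_mod_cast h2
          _ = (N : ℝ) - i - F.card := by rw [Nat.cast_sub h3, Nat.cast_sub hi.le]
          _ ≤ (1 - (F.card : ℝ) / N) * (N - i) := by
            have : (F.card : ℝ) / N * N = F.card := by field_simp
            have : (0 : ℝ) ≤ (F.card : ℝ) / N * i := by positivity
            nlinarith
          _ ≤ Real.exp (-((F.card : ℝ) / N)) * (N - i) := by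
            gcongr
            linarith [Real.add_one_le_exp (-((F.card : ℝ) / N))]
      · rw [one_mul, ← Nat.cast_sub hi.le, ← hl.card_remainingEdges]
        exact_mod_cast Finset.card_filter_le _ _)
  refine le_trans (MeasureTheory.measure_mono ?_)
    (key.trans (ENNReal.ofReal_le_ofReal ((placement_prod_le h12 (by omega) R hRsub
      (by positivity) (by positivity)).trans_eq (by rw [hRcard]))))
  rintro ω ⟨h1, h2⟩ j hj
  refine (hC _ _).2 ⟨fun e he => ?_, fun _ hjm hF => ?_⟩
  · subst he
    exact (h1 e).2
  · exact h2 _ hF (List.mem_take_iff_getElem.2 ⟨j, by omega, rfl⟩)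

/-- The probability that the edges of `D` are all among the first `m₂` while the first `m₁` edges
avoid `F`. -/
theorem processLaw_present_absent_le {m₁ m₂ : ℕ} (h12 : m₁ ≤ m₂) (hm : 2 * m₂ ≤ n.choose d)
    (D F : Finset (Finset (Fin n))) (hF : F ⊆ potentialEdges n d) (hDF : Disjoint D F) :
    (processLaw n d).toOuterMeasure
      {ω | (∀ e ∈ D, e ∈ ω.take m₂) ∧ ∀ e ∈ F, e ∉ ω.take m₁} ≤
      ENNReal.ofReal ((2 * m₂ / (n.choose d : ℝ)) ^ D.card *
        Real.exp (-((F.card : ℝ) / n.choose d) * ((m₁ : ℝ) - D.card))) := by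
  classical
  -- Union over the `m₂ ^ D.card` assignments of positions, which turns `2 / N` into `2 * m₂ / N`.
  have hsub : {ω : List (Finset (Fin n)) | (∀ e ∈ D, e ∈ ω.take m₂) ∧ ∀ e ∈ F, e ∉ ω.take m₁} ⊆
      ⋃ φ : D → Fin m₂, {ω | (∀ e : D, ∃ h : (φ e : ℕ) < ω.length, ω[(φ e : ℕ)] = e) ∧
        ∀ e ∈ F, e ∉ ω.take m₁} := by
    rintro ω ⟨h1, h2⟩
    have : ∀ e : D, ∃ i : Fin m₂, ∃ h : (i : ℕ) < ω.length, ω[(i : ℕ)] = e := by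
      intro e
      obtain ⟨j, hj, he⟩ := List.mem_take_iff_getElem.1 (h1 e e.2)
      exact ⟨⟨j, by omega⟩, hj.trans_le (min_le_right _ _), he⟩
    choose φ hφ using this
    exact Set.mem_iUnion.2 ⟨φ, hφ, h2⟩
  calc _ ≤ _ := MeasureTheory.measure_mono hsub
    _ ≤ _ := MeasureTheory.measure_iUnion_fintype_le _ _
    _ ≤ _ := Finset.sum_le_sum fun φ _ => processLaw_placement_le h12 hm D F hF hDF φ
    _ = _ := by
      rw [Finset.sum_const, Finset.card_univ, Fintype.card_fun, Fintype.card_fin, Fintype.card_coe,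
        nsmul_eq_mul, ← ENNReal.ofReal_natCast, ← ENNReal.ofReal_mul (by positivity)]
      congr 1
      push_cast
      rw [← mul_assoc, ← mul_pow]
      congr 2
      ring

end RandomHypergraph

/-! ### The second moment method and isolated vertices -/

namespace RandomHypergraph

open MeasureTheory

/-- The second moment method for pairwise negatively correlated events of equal probability. -/
theorem second_moment_bound {Ω ι : Type*} [Fintype ι] (P : PMF Ω) (A : ι → Set Ω) {q : ℝ}
    (h1 : ∀ i, (P.toOuterMeasure (A i)).toReal = q)
    (h2 : ∀ i j, i ≠ j → (P.toOuterMeasure (A i ∩ A j)).toReal ≤ q ^ 2) :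
    (P.toOuterMeasure {ω | ∀ i, ω ∉ A i}).toReal * (Fintype.card ι * q) ≤ 1 := by
  classical
  let : MeasurableSpace Ω := ⊤
  have hm : ∀ s : Set Ω, MeasurableSet s := fun s => trivial
  have hreal : ∀ s, P.toMeasure.real s = (P.toOuterMeasure s).toReal := fun s => by
    rw [Measure.real, PMF.toMeasure_apply_eq_toOuterMeasure_apply _ (hm s)]
  set n : ℝ := (Fintype.card ι : ℝ) with hn
  have hq : ∀ _ : ι, 0 ≤ q := fun i => (h1 i) ▸ ENNReal.toReal_nonneg
  set X : Ω → ℝ := fun ω => ∑ i, (A i).indicator 1 ω with hX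
  have hint : ∀ s : Set Ω, Integrable (s.indicator (1 : Ω → ℝ)) P.toMeasure := fun s =>
    (integrable_indicator_iff (hm s)).2 (integrable_const 1).integrableOn
  have hintX : Integrable X P.toMeasure := integrable_finsetSum _ fun i _ => hint _
  have hXX : ∀ ω, X ω ^ 2 = ∑ i, ∑ j, (A i ∩ A j).indicator (1 : Ω → ℝ) ω := by
    intro ω
    rw [hX, sq, Finset.sum_mul_sum]
    refine Finset.sum_congr rfl fun i _ => Finset.sum_congr rfl fun j _ => ?_
    rw [Set.inter_indicator_one]; rfl
  have hintXX : Integrable (fun ω => X ω ^ 2) P.toMeasure := by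
    simp only [hXX]
    exact integrable_finsetSum _ fun i _ => integrable_finsetSum _ fun j _ => hint _
  have hEX : ∫ ω, X ω ∂P.toMeasure = n * q := by
    rw [hX, integral_finsetSum _ fun i _ => hint _]
    simp only [integral_indicator_one (hm _), hreal, h1, Finset.sum_const, Finset.card_univ,
      nsmul_eq_mul, n]
  have hEXX : ∫ ω, X ω ^ 2 ∂P.toMeasure ≤ n * q + n ^ 2 * q ^ 2 := by
    simp only [hXX]
    rw [integral_finsetSum _ fun i _ => integrable_finsetSum _ fun j _ => hint _]
    have : ∀ i j, ∫ ω, (A i ∩ A j).indicator (1 : Ω → ℝ) ω ∂P.toMeasure ≤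
        (if i = j then q else 0) + q ^ 2 := by
      intro i j
      rw [integral_indicator_one (hm _), hreal]
      split_ifs with h
      · subst h
        rw [Set.inter_self, h1]
        nlinarith
      · linarith [h2 i j h]
    calc _ = ∑ i, ∑ j, ∫ ω, (A i ∩ A j).indicator (1 : Ω → ℝ) ω ∂P.toMeasure :=
          Finset.sum_congr rfl fun i _ => integral_finsetSum _ fun j _ => hint _
      _ ≤ ∑ i, ∑ j, ((if i = j then q else 0) + q ^ 2) :=
          Finset.sum_le_sum fun i _ => Finset.sum_le_sum fun j _ => this i j
      _ = _ := by
        simp only [Finset.sum_add_distrib, Finset.sum_ite_eq, Finset.mem_univ, if_true,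
          Finset.sum_const, Finset.card_univ, nsmul_eq_mul, n]
        ring
  have hvar : ∫ ω, (X ω - n * q) ^ 2 ∂P.toMeasure ≤ n * q := by
    have : ∀ ω, (X ω - n * q) ^ 2 = X ω ^ 2 - (2 * (n * q)) * X ω + (n * q) ^ 2 := fun ω => by ring
    simp only [this]
    rw [integral_add (f := fun ω => X ω ^ 2 - 2 * (n * q) * X ω)
        (hintXX.sub (hintX.const_mul _)) (integrable_const _), integral_sub hintXX (hintX.const_mul _), integral_const_mul, hEX]
    simp only [integral_const, probReal_univ, one_smul]
    nlinarith
  -- Chebyshev: where no `A i` occurs, `X = 0`, so the squared deviation from the mean equals `(n *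
  -- q) ^ 2`.
  have hlow : (P.toOuterMeasure {ω | ∀ i, ω ∉ A i}).toReal * (n * q) ^ 2 ≤ n * q := by
    refine le_trans ?_ hvar
    rw [← hreal, ← integral_indicator_one (hm _), ← integral_mul_const]
    refine integral_mono ((hint _).mul_const _) ?_ fun ω => ?_
    · have : (fun ω => (X ω - n * q) ^ 2) =
          fun ω => X ω ^ 2 - (2 * (n * q)) * X ω + (n * q) ^ 2 := by ext ω; ring
      rw [this]
      exact (hintXX.sub (hintX.const_mul _)).add (integrable_const _)
    · by_cases hω : ω ∈ {ω | ∀ i, ω ∉ A i}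
      · have : X ω = 0 := Finset.sum_eq_zero fun i _ => Set.indicator_of_notMem (hω i) _
        simp [Set.indicator_of_mem hω, this]
      · simp only [Set.indicator_of_notMem hω, zero_mul]
        positivity
  rcases isEmpty_or_nonempty ι with hι | ⟨⟨i⟩⟩
  · simp [hn]
  rcases (hq i).eq_or_lt with h0 | h0
  · simp [← h0]
  · have hn : 0 < n := by simp only [n]; exact_mod_cast Fintype.card_pos_iff.2 ⟨i⟩
    have hnq := mul_pos hn h0
    refine le_of_mul_le_mul_right ?_ hnq
    rw [one_mul, mul_assoc, ← sq]
    exact hlow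

/-- The potential edges that meet the vertex set `W`. -/
def edgesMeeting (n d : ℕ) (W : Finset (Fin n)) : Finset (Finset (Fin n)) :=
  (potentialEdges n d).filter fun e => ¬ Disjoint e W

theorem edgesMeeting_subset {n d : ℕ} (W : Finset (Fin n)) :
    edgesMeeting n d W ⊆ potentialEdges n d := Finset.filter_subset _ _

theorem card_edgesMeeting_add {n d : ℕ} (W : Finset (Fin n)) :
    (edgesMeeting n d W).card + (n - W.card).choose d = n.choose d := by
  have h : ((potentialEdges n d).filter fun e => Disjoint e W) =
      Finset.powersetCard d Wᶜ := by
    ext e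
    rw [Finset.mem_filter, mem_potentialEdges, Finset.mem_powersetCard,
      Finset.subset_compl_iff_disjoint_right, and_comm]
  have h2 := Finset.card_filter_add_card_filter_not (s := potentialEdges n d)
    (fun e => Disjoint e W)
  rw [h, Finset.card_powersetCard, Finset.card_compl, Fintype.card_fin, card_potentialEdges] at h2
  rw [edgesMeeting]
  omega

/-- For `j ≥ d` the ratios `(j + 1).choose d / j.choose d = (j + 1) / (j + 1 - d)` decrease in `j`.
Together with convexity this yields negative correlation of isolation events. -/
theorem choose_log_concave (j d : ℕ) :
    (j.choose d : ℝ) * (j + 2).choose d ≤ ((j + 1).choose d : ℝ) ^ 2 := by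
  rcases lt_or_ge j d with h | h
  · rw [Nat.choose_eq_zero_of_lt h]
    simp only [Nat.cast_zero, zero_mul]
    positivity
  obtain ⟨t, rfl⟩ := Nat.exists_eq_add_of_le h
  have h1 := Nat.choose_mul_succ_eq (d + t) d
  have h2 := Nat.choose_mul_succ_eq (d + t + 1) d
  rw [show d + t + 1 - d = t + 1 by omega] at h1
  rw [show d + t + 1 + 1 - d = t + 2 by omega, show d + t + 1 + 1 = d + t + 2 by omega] at h2
  have h1' : ((d + t).choose d : ℝ) * (d + t + 1) = (d + t + 1).choose d * (t + 1) := by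
    exact_mod_cast h1
  have h2' : ((d + t + 1).choose d : ℝ) * (d + t + 2) = (d + t + 2).choose d * (t + 2) := by
    exact_mod_cast h2
  set a : ℝ := ((d + t).choose d : ℝ)
  set b : ℝ := ((d + t + 1).choose d : ℝ)
  set c : ℝ := ((d + t + 2).choose d : ℝ)
  have hpos : (0 : ℝ) < (d + t + 1) * (t + 2) := by positivity
  refine le_of_mul_le_mul_right ?_ hpos
  calc a * c * ((d + t + 1) * (t + 2)) = (a * (d + t + 1)) * (c * (t + 2)) := by ring
    _ = b ^ 2 * ((t + 1) * (d + t + 2)) := by rw [h1', ← h2']; ring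
    _ ≤ b ^ 2 * ((d + t + 1) * (t + 2)) := by
      gcongr ?_ * ?_
      have : (0 : ℝ) ≤ d := by positivity
      nlinarith

theorem choose_convex (j d : ℕ) (hd : 1 ≤ d) :
    2 * ((j + 1).choose d : ℝ) ≤ j.choose d + (j + 2).choose d := by
  obtain ⟨e, rfl⟩ := Nat.exists_eq_add_of_le' hd
  have h1 := Nat.choose_succ_succ' (j + 1) e
  have h2 := Nat.choose_succ_succ' j e
  have h3 := Nat.choose_le_choose e (Nat.le_succ j)
  have : 2 * (j + 1).choose (e + 1) ≤ j.choose (e + 1) + (j + 2).choose (e + 1) := by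
    simp only [Nat.succ_eq_add_one] at h3
    rw [show j + 1 + 1 = j + 2 from rfl] at h1
    omega
  exact_mod_cast this

/-- The first `m` edges avoid the vertex `v`. -/
def isolatedEvent (n d m : ℕ) (v : Fin n) : Set (List (Finset (Fin n))) :=
  {ω | ∀ e ∈ edgesMeeting n d {v}, e ∉ ω.take m}

/-- Both the single and the joint isolation probabilities are explicit products, so negative
correlation can be checked factor by factor; the bound on `m` keeps the factors nonnegative. -/
theorem processLaw_no_isolated_le {n d m : ℕ} (hn : 2 ≤ n) (hd : 1 ≤ d)
    (hm : m ≤ (n - 2).choose d) :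
    ((processLaw n d).toOuterMeasure {ω | ∀ v, ω ∉ isolatedEvent n d m v}).toReal *
      (n * ∏ i ∈ Finset.range m,
        (1 - ((n.choose d : ℝ) - (n - 1).choose d) / ((n.choose d : ℝ) - i))) ≤ 1 := by
  classical
  obtain ⟨j, rfl⟩ := Nat.exists_eq_add_of_le' hn
  rw [Nat.add_sub_cancel] at hm
  rw [show j + 2 - 1 = j + 1 by omega]
  have hmono : j.choose d ≤ (j + 1).choose d := Nat.choose_le_choose d (by omega)
  have hmono' : (j + 1).choose d ≤ (j + 2).choose d := Nat.choose_le_choose d (by omega)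
  have hnn : ∀ a : ℕ, j.choose d ≤ a → ∀ i ∈ Finset.range m,
      0 ≤ 1 - (((j + 2).choose d : ℝ) - a) / (((j + 2).choose d : ℝ) - i) := by
    intro a ha i hi
    have hi' : i < j.choose d := (Finset.mem_range.1 hi).trans_le hm
    have h1 : (i : ℝ) < (j + 2).choose d := by exact_mod_cast (by omega)
    have h2 : (i : ℝ) ≤ a := by exact_mod_cast (by omega)
    rw [sub_nonneg, div_le_one (by linarith)]
    linarith
  have hprob : ∀ W : Finset (Fin (j + 2)), W.card ≤ 2 →
      ((processLaw (j + 2) d).toOuterMeasure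
        {ω | ∀ e ∈ edgesMeeting (j + 2) d W, e ∉ ω.take m}).toReal =
      ∏ i ∈ Finset.range m, (1 - (((j + 2).choose d : ℝ) - (j + 2 - W.card).choose d) /
        (((j + 2).choose d : ℝ) - i)) := by
    intro W hW
    have hc := card_edgesMeeting_add (d := d) W
    have hc2 : j.choose d ≤ (j + 2 - W.card).choose d := Nat.choose_le_choose d (by omega)
    have hc' : ((edgesMeeting (j + 2) d W).card : ℝ) =
        ((j + 2).choose d : ℝ) - (j + 2 - W.card).choose d := by
      rw [eq_sub_iff_add_eq]; exact_mod_cast hc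
    rw [processLaw_avoid _ (edgesMeeting_subset W) (by omega), hc', ENNReal.toReal_ofReal]
    exact Finset.prod_nonneg fun i hi => hnn _ hc2 i hi
  have := second_moment_bound (processLaw (j + 2) d) (isolatedEvent (j + 2) d m)
    (q := ∏ i ∈ Finset.range m, (1 - (((j + 2).choose d : ℝ) - (j + 1).choose d) /
        (((j + 2).choose d : ℝ) - i)))
    (fun v => by simpa [isolatedEvent] using hprob {v} (by simp)) ?_
  · simpa only [Fintype.card_fin] using this
  · intro u v huv
    have hset : isolatedEvent (j + 2) d m u ∩ isolatedEvent (j + 2) d m v =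
        {ω | ∀ e ∈ edgesMeeting (j + 2) d {u, v}, e ∉ ω.take m} := by
      ext ω
      simp only [isolatedEvent, edgesMeeting, Set.mem_inter_iff, Set.mem_ofPred_eq,
        Finset.mem_filter, Finset.disjoint_singleton_right, Finset.disjoint_insert_right]
      grind
    rw [hset, hprob {u, v} Finset.card_le_two, ← Finset.prod_pow, Finset.card_pair huv,
      Nat.add_sub_cancel]
    refine Finset.prod_le_prod (hnn _ le_rfl) fun i hi => ?_
    have hi' : i < j.choose d := (Finset.mem_range.1 hi).trans_le hm
    have h1 : (0 : ℝ) < ((j + 2).choose d : ℝ) - i := by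
      rw [sub_pos]; exact_mod_cast (by omega)
    have h2 := choose_log_concave j d
    have h3 := choose_convex j d hd
    rw [one_sub_div h1.ne', one_sub_div h1.ne', div_pow, div_le_div_iff₀ h1 (by positivity)]
    -- With `a`, `b`, `c` the binomials at `j`, `j + 1`, `j + 2`, this is `(a - i) (c - i) ≤ (b - i)
    -- ^ 2`, which follows from `a c ≤ b ^ 2` and `2 b ≤ a + c`.
    have : (((j + 2).choose d : ℝ) - i - ((j + 2).choose d - j.choose d)) *
        (((j + 2).choose d : ℝ) - i) ≤
        (((j + 2).choose d : ℝ) - i - ((j + 2).choose d - (j + 1).choose d)) ^ 2 := by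
      have : (0 : ℝ) ≤ i := by positivity
      nlinarith
    calc _ = _ * (((j + 2).choose d : ℝ) - i) := by rw [sq, ← mul_assoc]
      _ ≤ _ := mul_le_mul_of_nonneg_right this h1.le

end RandomHypergraph

/-! ### Deterministic structure: degrees, separators, obstructions -/

namespace RandomHypergraph

variable {n : ℕ}

/-- The edges inserted up to time `t`. -/
def edgesAt (n t : ℕ) (ω : List (Finset (Fin n))) : Finset (Finset (Fin n)) := (ω.take t).toFinset

theorem mem_edgesAt {t : ℕ} {ω : List (Finset (Fin n))} {e : Finset (Fin n)} :
    e ∈ edgesAt n t ω ↔ e ∈ ω.take t := List.mem_toFinset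

theorem edgesAt_mono {s t : ℕ} (h : s ≤ t) (ω : List (Finset (Fin n))) :
    edgesAt n s ω ⊆ edgesAt n t ω := fun _ he =>
  mem_edgesAt.2 ((List.take_subset_take_left ω h) (mem_edgesAt.1 he))

theorem coe_mem_edgeSet_process {t : ℕ} {ω : List (Finset (Fin n))} {e : Finset (Fin n)} :
    (e : Set (Fin n)) ∈ E(process n t ω) ↔ e ∈ edgesAt n t ω := by
  rw [mem_edgesAt]
  constructor
  · rintro ⟨f, hf, hfe⟩
    exact (Finset.coe_injective hfe) ▸ hf
  · exact fun h => ⟨e, h, rfl⟩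

theorem exists_of_mem_edgeSet_process {t : ℕ} {ω : List (Finset (Fin n))} {s : Set (Fin n)}
    (hs : s ∈ E(process n t ω)) : ∃ e ∈ edgesAt n t ω, (e : Set (Fin n)) = s := by
  obtain ⟨f, hf, hfe⟩ := hs
  exact ⟨f, mem_edgesAt.2 hf, hfe⟩

theorem minDegreeAtLeast_process_iff {k t : ℕ} {ω : List (Finset (Fin n))} :
    (process n t ω).MinDegreeAtLeast k ↔ ∀ v, k ≤ ((edgesAt n t ω).filter (v ∈ ·)).card := by
  have hdeg : ∀ v, (process n t ω).degree v = ((edgesAt n t ω).filter (v ∈ ·)).card := by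
    intro v
    have : {e ∈ E(process n t ω) | v ∈ e} =
        (fun e : Finset (Fin n) => (e : Set (Fin n))) '' ((edgesAt n t ω).filter (v ∈ ·)) := by
      ext s
      constructor
      · rintro ⟨hs, hv⟩
        obtain ⟨e, he, rfl⟩ := exists_of_mem_edgeSet_process hs
        exact ⟨e, by simpa [he] using hv, rfl⟩
      · rintro ⟨e, he, rfl⟩
        rw [Finset.mem_coe, Finset.mem_filter] at he
        exact ⟨coe_mem_edgeSet_process.2 he.1, he.2⟩
    rw [Hypergraph.degree, this, Finset.coe_injective.encard_image, Set.encard_coe_eq_coe_finsetCard]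
  constructor
  · intro h v
    have := h v (Set.mem_univ v)
    rw [hdeg] at this
    exact_mod_cast this
  · intro h v _
    rw [hdeg]
    exact_mod_cast h v

/-- Pick a second vertex on each edge at `v` and pad. Deleting `T` isolates `v`; this serves both
the inequality `τ_k ≤ T_k` and the low-degree estimate. -/
theorem exists_hitting_set {𝓔 : Finset (Finset (Fin n))} {k : ℕ} (hkn : k ≤ n)
    (h𝓔 : ∀ e ∈ 𝓔, 2 ≤ e.card) {v : Fin n} (hv : (𝓔.filter (v ∈ ·)).card < k) :
    ∃ T : Finset (Fin n), T.card + 1 = k ∧ v ∉ T ∧ ∀ e ∈ 𝓔, v ∈ e → ¬ Disjoint e T := by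
  classical
  have h1 : ∀ e ∈ 𝓔, ∃ x ∈ e, x ≠ v := fun e he => Finset.exists_mem_ne (h𝓔 e he) v
  have : Nonempty (Fin n) := ⟨v⟩
  choose! f hf using h1
  set T₀ := (𝓔.filter (v ∈ ·)).image f with hT₀
  have hsub : T₀ ⊆ Finset.univ.erase v := by
    intro x hx
    obtain ⟨e, he, rfl⟩ := Finset.mem_image.1 hx
    exact Finset.mem_erase.2 ⟨(hf e (Finset.mem_filter.1 he).1).2, Finset.mem_univ _⟩
  have hcard : T₀.card < k := Finset.card_image_le.trans_lt hv
  obtain ⟨T, hT1, hT2, hT3⟩ := Finset.exists_subsuperset_card_eq hsub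
    (n := k - 1) (by omega) (by rw [Finset.card_erase_of_mem (Finset.mem_univ _)]; simp; omega)
  refine ⟨T, by omega, fun h => (Finset.mem_erase.1 (hT2 h)).1 rfl, fun e he hve hdis => ?_⟩
  exact Finset.disjoint_left.1 hdis (hf e he).1
    (hT1 (Finset.mem_image_of_mem f (Finset.mem_filter.2 ⟨he, hve⟩)))

theorem minDegreeAtLeast_of_kConnected {k t : ℕ} {ω : List (Finset (Fin n))}
    (h𝓔 : ∀ e ∈ edgesAt n t ω, 2 ≤ e.card) (h : (process n t ω).KConnected k) :
    (process n t ω).MinDegreeAtLeast k := by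
  classical
  rw [minDegreeAtLeast_process_iff]
  by_contra! hv
  obtain ⟨v, hv⟩ := hv
  have hn : k < n := by
    have h1 := h.1
    have : V(process n t ω) = Set.univ := rfl
    rw [this, Set.encard_univ] at h1
    simpa using h1
  obtain ⟨T, hT, hvT, hhit⟩ := exists_hitting_set hn.le h𝓔 hv
  have hcon := h.2 T (Set.subset_univ _) (by
    rw [Set.encard_coe_eq_coe_finsetCard]; exact_mod_cast hT)
  obtain ⟨w, hw⟩ : ∃ w, w ∉ insert v T := by
    by_contra! hall
    have : (insert v T).card = n := by
      rw [Finset.eq_univ_iff_forall.2 hall]; simp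
    have := Finset.card_insert_le v T
    omega
  rw [Finset.mem_insert, not_or] at hw
  have hpath := hcon.2 v ⟨Set.mem_univ _, hvT⟩ w ⟨Set.mem_univ _, hw.2⟩
  rcases hpath.cases_head with h' | ⟨y, ⟨s, hs, hvs, -⟩, -⟩
  · exact hw.1 h'.symm
  · obtain ⟨e, he, rfl⟩ := exists_of_mem_edgeSet_process hs.1
    refine hhit e he hvs ?_
    exact_mod_cast hs.2

/-- Deleting `S` separates the nonempty vertex set `A` from at least one other vertex. -/
def Separates (𝓔 : Finset (Finset (Fin n))) (S A : Finset (Fin n)) : Prop :=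
  Disjoint A S ∧ A.Nonempty ∧ (A ∪ S)ᶜ.Nonempty ∧
    ∀ e ∈ 𝓔, Disjoint e S → ¬ Disjoint e A → e ⊆ A

/-- `A` is the set of vertices still reachable from one of two disconnected vertices; `k < n`
excludes failure by size or by an empty remainder. -/
theorem exists_separates_of_not_kConnected {k t : ℕ} {ω : List (Finset (Fin n))} (hkn : k < n)
    (h : ¬ (process n t ω).KConnected k) :
    ∃ S A, S.card < k ∧ Separates (edgesAt n t ω) S A := by
  classical
  have hV : V(process n t ω) = Set.univ := rfl
  rw [Hypergraph.KConnected, not_and_or] at h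
  rcases h with h | h
  · rw [hV, Set.encard_univ] at h
    simp at h
    omega
  push Not at h
  obtain ⟨S', -, hS, hcon⟩ := h
  obtain ⟨S, rfl⟩ := (Set.toFinite S').exists_finset_coe
  rw [Set.encard_coe_eq_coe_finsetCard] at hS
  have hS : S.card + 1 = k := by exact_mod_cast hS
  rw [Hypergraph.Connected, not_and_or] at hcon
  rcases hcon with hcon | hcon
  · exfalso
    apply hcon
    by_contra hemp
    rw [Set.not_nonempty_iff_eq_empty] at hemp
    have : S = Finset.univ := by
      rw [Finset.eq_univ_iff_forall]
      intro x
      by_contra hx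
      have : x ∈ V((process n t ω).deleteVertices S) := ⟨Set.mem_univ _, hx⟩
      rw [hemp] at this
      exact this
    rw [this] at hS
    simp at hS
    omega
  push Not at hcon
  obtain ⟨x, hx, y, hy, hxy⟩ := hcon
  set Adj' := ((process n t ω).deleteVertices S).Adj with hAdj
  refine ⟨S, Finset.univ.filter fun z => Relation.ReflTransGen Adj' x z, by omega, ?_, ?_, ?_, ?_⟩
  · rw [Finset.disjoint_left]
    intro z hz hzS
    rw [Finset.mem_filter] at hz
    rcases hz.2.cases_tail with h' | ⟨w, -, ⟨s, hs, -, hzs⟩⟩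
    · exact hx.2 (h' ▸ hzS)
    · exact Set.disjoint_left.1 hs.2 hzs hzS
  · exact ⟨x, by simp [Relation.ReflTransGen.refl]⟩
  · refine ⟨y, ?_⟩
    rw [Finset.mem_compl, Finset.mem_union, not_or]
    exact ⟨by simpa using hxy, hy.2⟩
  · intro e he heS heA z hz
    rw [Finset.not_disjoint_iff] at heA
    obtain ⟨w, hwe, hw⟩ := heA
    rw [Finset.mem_filter] at hw ⊢
    refine ⟨Finset.mem_univ _, hw.2.tail ⟨e, ⟨coe_mem_edgeSet_process.2 he, ?_⟩, hwe, hz⟩⟩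
    exact_mod_cast heS

/-- An edge avoiding `S` lies wholly inside or wholly outside `A`. This symmetry makes a smallest
side contain at most half of the vertices. -/
theorem Separates.compl {𝓔 : Finset (Finset (Fin n))} {S A : Finset (Fin n)}
    (h : Separates 𝓔 S A) : Separates 𝓔 S (A ∪ S)ᶜ := by
  classical
  obtain ⟨h1, h2, h3, h4⟩ := h
  refine ⟨?_, h3, ?_, ?_⟩
  · rw [Finset.disjoint_left]
    intro x hx hxS
    simp [hxS] at hx
  · obtain ⟨x, hx⟩ := h2
    exact ⟨x, by simpa [hx] using Finset.disjoint_left.1 h1 hx⟩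
  · intro e he heS heA x hx
    rw [Finset.mem_compl, Finset.mem_union, not_or]
    refine ⟨fun hxA => ?_, Finset.disjoint_left.1 heS hx⟩
    have := h4 e he heS (Finset.not_disjoint_iff.2 ⟨x, hx, hxA⟩)
    apply heA
    rw [Finset.disjoint_left]
    intro y hy hy'
    simp [this hy] at hy'

/-- What a minimal separator leaves behind in a hypergraph of minimum degree at least `k` that has
a separator of fewer than `k` vertices. -/
theorem exists_obstruction {𝓔 : Finset (Finset (Fin n))} {k : ℕ} (h𝓔 : ∀ e ∈ 𝓔, 2 ≤ e.card)
    (hdeg : ∀ v, k ≤ (𝓔.filter (v ∈ ·)).card) (hsep : ∃ S A, S.card < k ∧ Separates 𝓔 S A) :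
    ∃ (S A : Finset (Fin n)) (f : Fin n → Finset (Fin n)) (g : Finset (Fin n)),
      S.card < k ∧ Disjoint A S ∧ A.Nonempty ∧ 2 * A.card ≤ n ∧
      (∀ x ∈ S, f x ∈ 𝓔 ∧ f x ∩ S = {x} ∧ ¬ Disjoint (f x) A) ∧
      g ∈ 𝓔 ∧ (∀ x ∈ S, g ≠ f x) ∧
      (A.card = 1 ∧ A ⊆ g ∧ ¬ Disjoint g S ∨ 2 ≤ A.card ∧ g ⊆ A) ∧
      ∀ e ∈ 𝓔, Disjoint e S → (e ∩ A).card ≠ 1 := by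
  classical
  obtain ⟨S, ⟨hSk, A₀, hA₀⟩, hSmin⟩ := exists_minimalFor_of_wellFoundedLT
    (fun S : Finset (Fin n) => S.card < k ∧ ∃ A, Separates 𝓔 S A) Finset.card
    (let ⟨S, A, h1, h2⟩ := hsep; ⟨S, h1, A, h2⟩)
  obtain ⟨A, hA, hAmin⟩ := exists_minimalFor_of_wellFoundedLT
    (fun A : Finset (Fin n) => Separates 𝓔 S A) Finset.card ⟨A₀, hA₀⟩
  have hAmin' : ∀ B, Separates 𝓔 S B → A.card ≤ B.card := fun B hB => by
    rcases le_total A.card B.card with h | h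
    · exact h
    · exact hAmin hB h
  obtain ⟨hdis, hne, hcne, hcl⟩ := id hA
  -- Without such an edge, `x` could be put back: `S.erase x` would still separate `A`, against the
  -- minimality of `S`.
  have hf : ∀ x ∈ S, ∃ e ∈ 𝓔, e ∩ S = {x} ∧ ¬ Disjoint e A := by
    intro x hx
    by_contra! hcon
    have hlt : (S.erase x).card < S.card := Finset.card_erase_lt_of_mem hx
    refine absurd (hSmin (j := S.erase x) ⟨by omega, A, ?_⟩ hlt.le) (by simpa using hlt)
    refine ⟨hdis.mono_right (Finset.erase_subset _ _), hne, ⟨x, ?_⟩, fun e he heS heA => ?_⟩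
    · simpa using fun h => Finset.disjoint_left.1 hdis h hx
    · by_cases hxe : x ∈ e
      · refine absurd (hcon e he ?_) heA
        ext y
        rw [Finset.mem_inter, Finset.mem_singleton]
        constructor
        · rintro ⟨hy, hyS⟩
          by_contra hyx
          exact Finset.disjoint_left.1 heS hy (Finset.mem_erase.2 ⟨hyx, hyS⟩)
        · rintro rfl
          exact ⟨hxe, hx⟩
      · refine hcl e he ?_ heA
        rw [Finset.disjoint_left]
        intro y hy hyS
        exact Finset.disjoint_left.1 heS hy (Finset.mem_erase.2 ⟨fun h => hxe (h ▸ hy), hyS⟩)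
  choose! f hf using hf
  have hhalf : 2 * A.card ≤ n := by
    have h1 := hAmin' _ hA.compl
    have h2 := Finset.card_compl (A ∪ S)
    have h3 : A.card ≤ (A ∪ S).card := Finset.card_le_card Finset.subset_union_left
    rw [Fintype.card_fin] at h2
    omega
  have hone : ∀ e ∈ 𝓔, Disjoint e S → (e ∩ A).card ≠ 1 := by
    intro e he heS h1
    have h2 := hcl e he heS (fun h => by
      rw [Finset.disjoint_iff_inter_eq_empty.1 h] at h1; simp at h1)
    rw [Finset.inter_eq_left.2 h2] at h1
    have := h𝓔 e he
    omega
  have hcard : 1 ≤ A.card := hne.card_pos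
  rcases hcard.eq_or_lt with h1 | h2
  · obtain ⟨v, rfl⟩ := Finset.card_eq_one.1 h1.symm
    -- The degree of `v` is at least `k`, which exceeds the number of edges `f x`, so `v` lies on a
    -- further edge. That edge must meet `S`, since otherwise it would be contained in `{v}`.
    have : ¬ (𝓔.filter (v ∈ ·)) ⊆ S.image f := fun h => by
      have := (Finset.card_le_card h).trans Finset.card_image_le
      have := hdeg v
      omega
    obtain ⟨g, hg, hgf⟩ := Finset.not_subset.1 this
    rw [Finset.mem_filter] at hg
    refine ⟨S, {v}, f, g, hSk, hdis, hne, hhalf, hf, hg.1, ?_, Or.inl ⟨by simp, ?_, ?_⟩, hone⟩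
    · exact fun x hx h => hgf (Finset.mem_image.2 ⟨x, hx, h.symm⟩)
    · simpa using hg.2
    · intro hgS
      have := Finset.card_le_card (hcl g hg.1 hgS (by simpa using hg.2))
      have := h𝓔 g hg.1
      simp at *
      omega
  -- If no edge lay inside `A`, no edge avoiding `S` would meet `A`, and a single vertex of `A`
  -- would be a smaller side.
  · obtain ⟨g, hg, hgA⟩ : ∃ g ∈ 𝓔, g ⊆ A := by
      by_contra! hcon
      obtain ⟨v, hv⟩ := hne
      have := hAmin' {v} ⟨?_, by simp, ?_, ?_⟩
      · simp at this
        omega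
      · simpa using Finset.disjoint_left.1 hdis hv
      · obtain ⟨w, hw⟩ := hcne
        refine ⟨w, ?_⟩
        simp only [Finset.mem_compl, Finset.mem_union, not_or, Finset.mem_singleton] at hw ⊢
        exact ⟨fun h => hw.1 (h ▸ hv), hw.2⟩
      · intro e he heS hev
        refine absurd (hcl e he heS ?_) (hcon e he)
        rw [Finset.disjoint_singleton_right, not_not] at hev
        exact Finset.not_disjoint_iff.2 ⟨v, hev, hv⟩
    refine ⟨S, A, f, g, hSk, hdis, hne, hhalf, hf, hg, ?_, Or.inr ⟨h2, hgA⟩, hone⟩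
    rintro x hx rfl
    have : x ∈ f x ∩ S := by rw [(hf x hx).2.1]; simp
    rw [Finset.mem_inter] at this
    exact Finset.disjoint_left.1 hdis (hgA this.1) this.2

end RandomHypergraph

/-! ### Counting edges and the union bound over obstructions -/

namespace RandomHypergraph

variable {n d : ℕ}

theorem card_filter_superset_le (W : Finset (Fin n)) :
    ((potentialEdges n d).filter (W ⊆ ·)).card ≤ (n - W.card).choose (d - W.card) := by
  classical
  have h : (Finset.powersetCard (d - W.card) Wᶜ).card = (n - W.card).choose (d - W.card) := by
    rw [Finset.card_powersetCard, Finset.card_compl, Fintype.card_fin]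
  rw [← h]
  refine Finset.card_le_card_of_injOn (· \ W) ?_ ?_
  · intro e he
    rw [Finset.mem_coe, Finset.mem_filter, mem_potentialEdges] at he
    rw [Finset.mem_coe, Finset.mem_powersetCard, Finset.card_sdiff_of_subset he.2, he.1]
    refine ⟨?_, rfl⟩
    rw [Finset.subset_compl_iff_disjoint_right]
    exact Finset.sdiff_disjoint
  · intro e he f hf hef
    rw [Finset.mem_coe, Finset.mem_filter] at he hf
    rw [← Finset.sdiff_union_of_subset he.2, ← Finset.sdiff_union_of_subset hf.2]
    exact congrArg (· ∪ W) hef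

theorem card_edgesMeeting_le (A : Finset (Fin n)) :
    (edgesMeeting n d A).card ≤ A.card * (n - 1).choose (d - 1) := by
  classical
  have hsub : edgesMeeting n d A ⊆ A.biUnion fun v => (potentialEdges n d).filter ({v} ⊆ ·) := by
    intro e he
    rw [edgesMeeting, Finset.mem_filter, Finset.not_disjoint_iff] at he
    obtain ⟨he, v, hve, hvA⟩ := he
    exact Finset.mem_biUnion.2 ⟨v, hvA, Finset.mem_filter.2 ⟨he, by simpa using hve⟩⟩
  refine (Finset.card_le_card hsub).trans (Finset.card_biUnion_le_card_mul _ _ _ fun v _ => ?_)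
  simpa using card_filter_superset_le (d := d) {v}

/-- The potential edges that avoid `S` and have exactly one vertex in `A`. -/
def edgesLeaving (n d : ℕ) (A S : Finset (Fin n)) : Finset (Finset (Fin n)) :=
  (potentialEdges n d).filter fun e => Disjoint e S ∧ (e ∩ A).card = 1

/-- A vertex of `A` and `d - 1` vertices outside `A ∪ S` form such an edge, and the pair is
recovered from the edge. -/
theorem le_card_edgesLeaving (hd : 1 ≤ d) {A S : Finset (Fin n)} :
    A.card * (n - A.card - S.card).choose (d - 1) ≤ (edgesLeaving n d A (S \ A)).card := by
  classical
  set B := (A ∪ S)ᶜ with hB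
  have hBcard : n - A.card - S.card ≤ B.card := by
    rw [hB, Finset.card_compl, Fintype.card_fin]
    have := Finset.card_union_le A S
    omega
  calc A.card * (n - A.card - S.card).choose (d - 1)
      ≤ A.card * B.card.choose (d - 1) := by gcongr
    _ = (A ×ˢ Finset.powersetCard (d - 1) B).card := by
      rw [Finset.card_product, Finset.card_powersetCard]
    _ ≤ _ := by
      have hBA : ∀ T ⊆ B, ∀ x ∈ T, x ∉ A ∧ x ∉ S := fun T hT x hx => by
        simpa [hB] using hT hx
      refine Finset.card_le_card_of_injOn (fun p => insert p.1 p.2) ?_ ?_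
      · rintro ⟨v, T⟩ h
        rw [Finset.mem_coe, Finset.mem_product, Finset.mem_powersetCard] at h
        obtain ⟨hv, hT, hTc⟩ := h
        simp only at hv hT hTc
        have hvT : v ∉ T := fun h => (hBA T hT v h).1 hv
        rw [Finset.mem_coe, edgesLeaving, Finset.mem_filter, mem_potentialEdges,
          Finset.card_insert_of_notMem hvT]
        refine ⟨by omega, ?_, ?_⟩
        · rw [Finset.disjoint_left]
          intro x hx hxS
          rw [Finset.mem_sdiff] at hxS
          rcases Finset.mem_insert.1 hx with rfl | hx
          · exact hxS.2 hv
          · exact (hBA T hT x hx).2 hxS.1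
        · rw [Finset.card_eq_one]
          refine ⟨v, ?_⟩
          ext x
          rw [Finset.mem_inter, Finset.mem_insert, Finset.mem_singleton]
          constructor
          · rintro ⟨rfl | hx, hxA⟩
            · rfl
            · exact absurd hxA (hBA T hT x hx).1
          · rintro rfl
            exact ⟨Or.inl rfl, hv⟩
      · rintro ⟨v, T⟩ h ⟨v', T'⟩ h' heq
        rw [Finset.mem_coe, Finset.mem_product, Finset.mem_powersetCard] at h h'
        obtain ⟨hv, hT, -⟩ := h
        obtain ⟨hv', hT', -⟩ := h'
        simp only at hv hT hv' hT' heq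
        have hvv : v = v' := by
          have : v ∈ insert v' T' := heq ▸ Finset.mem_insert_self v T
          rcases Finset.mem_insert.1 this with h | h
          · exact h
          · exact absurd hv (hBA T' hT' v h).1
        subst hvv
        have hvT : v ∉ T := fun h => (hBA T hT v h).1 hv
        have hvT' : v ∉ T' := fun h => (hBA T' hT' v h).1 hv
        rw [← Finset.erase_insert hvT, heq, Finset.erase_insert hvT']

/-- The pairs of an edge that meets `A` and a vertex on it. -/
def flagsMeeting (n d : ℕ) (A : Finset (Fin n)) : Finset (Fin n × Finset (Fin n)) :=
  (Finset.univ ×ˢ edgesMeeting n d A).filter fun p => p.1 ∈ p.2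

theorem card_flagsMeeting_le (A : Finset (Fin n)) :
    (flagsMeeting n d A).card ≤ d * (A.card * (n - 1).choose (d - 1)) := by
  classical
  have h : flagsMeeting n d A ⊆
      (edgesMeeting n d A).biUnion fun e => e ×ˢ {e} := by
    rintro ⟨x, e⟩ h
    rw [flagsMeeting, Finset.mem_filter, Finset.mem_product] at h
    refine Finset.mem_biUnion.2 ⟨e, h.1.2, ?_⟩
    simpa using h.2
  refine (Finset.card_le_card h).trans ?_
  refine (Finset.card_biUnion_le_card_mul _ _ d fun e he => ?_).trans ?_
  · rw [Finset.card_product, Finset.card_singleton, mul_one,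
      mem_potentialEdges.1 (edgesMeeting_subset A he)]
  · rw [mul_comm]
    exact Nat.mul_le_mul_left _ (card_edgesMeeting_le A)

/-- The candidates for the extra edge of an obstruction with small side `A` and separator `S`. -/
def extraEdges (n d : ℕ) (A S : Finset (Fin n)) : Finset (Finset (Fin n)) :=
  if A.card = 1 then (potentialEdges n d).filter fun g => A ⊆ g ∧ ¬ Disjoint g S
  else Finset.powersetCard d A

/-- An upper bound for the number of candidates for the extra edge. -/
def extraCount (n d a s : ℕ) : ℕ :=
  if a = 1 then s * (n - 2).choose (d - 2) else a.choose d

theorem card_extraEdges_le {A S : Finset (Fin n)} (hAS : Disjoint A S) :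
    (extraEdges n d A S).card ≤ extraCount n d A.card S.card := by
  classical
  rw [extraEdges, extraCount]
  split_ifs with h
  · obtain ⟨v, rfl⟩ := Finset.card_eq_one.1 h
    have hsub : ((potentialEdges n d).filter fun g => {v} ⊆ g ∧ ¬ Disjoint g S) ⊆
        S.biUnion fun x => (potentialEdges n d).filter ({v, x} ⊆ ·) := by
      intro g hg
      rw [Finset.mem_filter, Finset.not_disjoint_iff] at hg
      obtain ⟨hg, hv, x, hxg, hxS⟩ := hg
      refine Finset.mem_biUnion.2 ⟨x, hxS, Finset.mem_filter.2 ⟨hg, ?_⟩⟩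
      exact Finset.insert_subset (by simpa using hv) (by simpa using hxg)
    refine (Finset.card_le_card hsub).trans (Finset.card_biUnion_le_card_mul _ _ _ fun x hx => ?_)
    have hvx : v ≠ x := fun h => Finset.disjoint_left.1 hAS (Finset.mem_singleton_self v) (h ▸ hx)
    simpa [Finset.card_pair hvx] using card_filter_superset_le (d := d) {v, x}
  · rw [Finset.card_powersetCard]

/-- The event that the edges witnessing an obstruction are among the first `m₂` edges, while the
first `m₁` edges contain none that leaves `A` in the absence of `S`. -/
def obstructionEvent (n d m₁ m₂ : ℕ) (A S : Finset (Fin n)) (D : Finset (Finset (Fin n))) :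
    Set (List (Finset (Fin n))) :=
  {ω | (∀ e ∈ D, e ∈ ω.take m₂) ∧ ∀ e ∈ edgesLeaving n d A S, e ∉ ω.take m₁}

/-- The bound for the probability of an obstruction with `a` vertices on the small side and `s`
vertices in the separator. -/
noncomputable def obstructionBound (n d m₁ m₂ a s : ℕ) : ℝ :=
  (n.choose a : ℝ) * ((d * (a * (n - 1).choose (d - 1)) : ℕ) : ℝ) ^ s * extraCount n d a s *
    ((2 * m₂ / (n.choose d : ℝ)) ^ (s + 1) *
      Real.exp (-(((a * (n - a - s).choose (d - 1) : ℕ) : ℝ) / n.choose d) *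
        ((m₁ : ℝ) - (s + 1 : ℕ))))

open Classical in
/-- The indices of the union bound for a fixed small side `A`. -/
noncomputable def obstructionIndex (n d s : ℕ) (A : Finset (Fin n)) :
    Finset ((_ : Fin s → Fin n × Finset (Fin n)) × Finset (Fin n)) :=
  ((Fintype.piFinset fun _ : Fin s => flagsMeeting n d A).filter fun p =>
      Disjoint A (Finset.univ.image fun i => (p i).1) ∧
      (Finset.univ.image fun i => (p i).1).card = s).sigma fun p =>
    (extraEdges n d A (Finset.univ.image fun i => (p i).1)).filter fun g =>
      (insert g (Finset.univ.image fun i => (p i).2)).card = s + 1 ∧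
      Disjoint (insert g (Finset.univ.image fun i => (p i).2))
        (edgesLeaving n d A (Finset.univ.image fun i => (p i).1))

/-- The separator is read off from its attached edges: choosing an edge that meets `A` and then one
of its `d` vertices replaces `n` free choices per separator vertex. -/
theorem card_obstructionIndex_le (s : ℕ) (A : Finset (Fin n)) :
    (obstructionIndex n d s A).card ≤
      (d * (A.card * (n - 1).choose (d - 1))) ^ s * extraCount n d A.card s := by
  classical
  rw [obstructionIndex, Finset.card_sigma]
  refine (Finset.sum_le_card_nsmul _ _ (extraCount n d A.card s) fun p hp => ?_).trans ?_
  · rw [Finset.mem_filter] at hp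
    refine (Finset.card_filter_le _ _).trans ((card_extraEdges_le hp.2.1).trans_eq ?_)
    rw [hp.2.2]
  · rw [smul_eq_mul]
    refine Nat.mul_le_mul_right _ ((Finset.card_filter_le _ _).trans ?_)
    rw [Fintype.card_piFinset_const]
    exact Nat.pow_le_pow_left (card_flagsMeeting_le A) s

theorem processLaw_obstruction_le {m₁ m₂ s : ℕ} (hd : 1 ≤ d) (h12 : m₁ ≤ m₂)
    (hm : 2 * m₂ ≤ n.choose d) (hs : s + 1 ≤ m₁) (A : Finset (Fin n)) :
    (processLaw n d).toOuterMeasure (⋃ q ∈ obstructionIndex n d s A,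
      obstructionEvent n d m₁ m₂ A (Finset.univ.image fun i => (q.1 i).1)
        (insert q.2 (Finset.univ.image fun i => (q.1 i).2))) ≤
      ENNReal.ofReal (((d * (A.card * (n - 1).choose (d - 1)) : ℕ) : ℝ) ^ s *
        extraCount n d A.card s * ((2 * m₂ / (n.choose d : ℝ)) ^ (s + 1) *
      Real.exp (-(((A.card * (n - A.card - s).choose (d - 1) : ℕ) : ℝ) / n.choose d) *
        ((m₁ : ℝ) - (s + 1 : ℕ))))) := by
  classical
  have hterm : ∀ q ∈ obstructionIndex n d s A, (processLaw n d).toOuterMeasure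
      (obstructionEvent n d m₁ m₂ A (Finset.univ.image fun i => (q.1 i).1)
        (insert q.2 (Finset.univ.image fun i => (q.1 i).2))) ≤
      ENNReal.ofReal ((2 * m₂ / (n.choose d : ℝ)) ^ (s + 1) *
      Real.exp (-(((A.card * (n - A.card - s).choose (d - 1) : ℕ) : ℝ) / n.choose d) *
        ((m₁ : ℝ) - (s + 1 : ℕ)))) := by
    rintro ⟨p, g⟩ hq
    rw [obstructionIndex, Finset.mem_sigma, Finset.mem_filter, Finset.mem_filter] at hq
    obtain ⟨⟨-, hdis, hcard⟩, -, hD, hDF⟩ := hq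
    simp only at hdis hcard hD hDF ⊢
    set S := Finset.univ.image fun i => (p i).1
    set D := insert g (Finset.univ.image fun i => (p i).2)
    refine (processLaw_present_absent_le h12 hm D (edgesLeaving n d A S)
      (Finset.filter_subset _ _) hDF).trans (ENNReal.ofReal_le_ofReal ?_)
    rw [hD]
    have hF := le_card_edgesLeaving (n := n) hd (A := A) (S := S)
    rw [Finset.sdiff_eq_self_of_disjoint hdis.symm, hcard] at hF
    refine mul_le_mul_of_nonneg_left (Real.exp_le_exp.2 ?_) (by positivity)
    have h1 : (0 : ℝ) ≤ (m₁ : ℝ) - (s + 1 : ℕ) := by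
      rw [sub_nonneg]; exact_mod_cast hs
    refine mul_le_mul_of_nonneg_right (neg_le_neg ?_) h1
    gcongr
  refine (MeasureTheory.measure_biUnion_finset_le _ _).trans ((Finset.sum_le_sum hterm).trans ?_)
  rw [Finset.sum_const, nsmul_eq_mul, ← ENNReal.ofReal_natCast,
    ← ENNReal.ofReal_mul (by positivity)]
  refine ENNReal.ofReal_le_ofReal (mul_le_mul_of_nonneg_right ?_ (by positivity))
  exact_mod_cast card_obstructionIndex_le s A

/-- The event that at some time from `m₁` to `m₂` the process has minimum degree at least `k` but
is not `k`-connected. -/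
def gapEvent (n d k m₁ m₂ : ℕ) : Set (List (Finset (Fin n))) :=
  {ω | (∀ e ∈ ω, e.card = d) ∧ ∃ t, m₁ ≤ t ∧ t ≤ m₂ ∧ (process n t ω).MinDegreeAtLeast k ∧
    ¬ (process n t ω).KConnected k}

/-- Edges present at time `t` are present at `m₂`, and edges absent at `t` are absent at `m₁`. So
the time drops out and no union over the window is needed. -/
theorem gapEvent_subset {k m₁ m₂ : ℕ} (hd : 2 ≤ d) (hkn : k < n) :
    gapEvent n d k m₁ m₂ ⊆ ⋃ s ∈ Finset.range k, ⋃ a ∈ Finset.Icc 1 (n / 2),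
      ⋃ A ∈ Finset.powersetCard a (Finset.univ : Finset (Fin n)),
        ⋃ q ∈ obstructionIndex n d s A,
          obstructionEvent n d m₁ m₂ A (Finset.univ.image fun i => (q.1 i).1)
            (insert q.2 (Finset.univ.image fun i => (q.1 i).2)) := by
  classical
  rintro ω ⟨hω, t, h1t, ht2, hmin, hcon⟩
  have hcardE : ∀ e ∈ edgesAt n t ω, e.card = d := fun e he =>
    hω e (List.mem_of_mem_take (mem_edgesAt.1 he))
  obtain ⟨S, A, f, g, hSk, hdis, hne, hhalf, hf, hg, hgf, hgA, hone⟩ :=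
    exists_obstruction (fun e he => (hcardE e he).symm ▸ hd)
      (minDegreeAtLeast_process_iff.1 hmin) (exists_separates_of_not_kConnected hkn hcon)
  set σ := S.equivFin with hσ
  set p : Fin S.card → Fin n × Finset (Fin n) := fun i => ((σ.symm i : Fin n), f (σ.symm i))
    with hp
  have hxf : ∀ x ∈ S, x ∈ f x := fun x hx => by
    have : x ∈ f x ∩ S := by rw [(hf x hx).2.1]; simp
    exact (Finset.mem_inter.1 this).1
  have himg1 : (Finset.univ.image fun i => (p i).1) = S := by
    ext x
    rw [Finset.mem_image]
    constructor
    · rintro ⟨i, -, rfl⟩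
      exact (σ.symm i).2
    · intro hx
      exact ⟨σ ⟨x, hx⟩, Finset.mem_univ _, by simp [hp]⟩
  have himg2 : (Finset.univ.image fun i => (p i).2) = S.image f := by
    ext e
    rw [Finset.mem_image, Finset.mem_image]
    constructor
    · rintro ⟨i, -, rfl⟩
      exact ⟨_, (σ.symm i).2, rfl⟩
    · rintro ⟨x, hx, rfl⟩
      exact ⟨σ ⟨x, hx⟩, Finset.mem_univ _, by simp [hp]⟩
  have hgS : g ∉ S.image f := fun h => by
    obtain ⟨x, hx, h⟩ := Finset.mem_image.1 h
    exact hgf x hx h.symm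
  -- `f x ∩ S = {x}` recovers `x`; hence there are exactly `S.card + 1` witnessing edges.
  have hfinj : Set.InjOn f S := by
    intro x hx y hy hxy
    have h1 := (hf x hx).2.1
    have h2 := (hf y hy).2.1
    rw [hxy, h2] at h1
    exact (Finset.singleton_inj.1 h1).symm
  have hDcard : (insert g (S.image f)).card = S.card + 1 := by
    rw [Finset.card_insert_of_notMem hgS, Finset.card_image_of_injOn hfinj]
  have hDE : ∀ e ∈ insert g (S.image f), e ∈ edgesAt n t ω := by
    intro e he
    rcases Finset.mem_insert.1 he with rfl | he
    · exact hg
    · obtain ⟨x, hx, rfl⟩ := Finset.mem_image.1 he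
      exact (hf x hx).1
  have hleave : ∀ e ∈ edgesLeaving n d A S, e ∉ edgesAt n t ω := by
    intro e he heE
    rw [edgesLeaving, Finset.mem_filter] at he
    exact hone e heE he.2.1 he.2.2
  simp only [Set.mem_iUnion]
  refine ⟨S.card, Finset.mem_range.2 hSk, A.card, Finset.mem_Icc.2 ⟨hne.card_pos, by omega⟩, A,
    Finset.mem_powersetCard.2 ⟨Finset.subset_univ _, rfl⟩, ⟨p, g⟩, ?_, ?_⟩
  · rw [obstructionIndex, Finset.mem_sigma, Finset.mem_filter, Finset.mem_filter]
    simp only [himg1, himg2]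
    refine ⟨⟨?_, hdis, trivial⟩, ?_, hDcard, ?_⟩
    · rw [Fintype.mem_piFinset]
      intro i
      have hi := hf _ (σ.symm i).2
      rw [flagsMeeting, Finset.mem_filter, Finset.mem_product, edgesMeeting, Finset.mem_filter,
        mem_potentialEdges]
      exact ⟨⟨Finset.mem_univ _, hcardE _ hi.1, hi.2.2⟩, hxf _ (σ.symm i).2⟩
    · rw [extraEdges]
      rcases hgA with ⟨h1, h2, h3⟩ | ⟨h1, h2⟩
      · rw [if_pos h1, Finset.mem_filter, mem_potentialEdges]
        exact ⟨hcardE g hg, h2, h3⟩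
      · rw [if_neg (by omega), Finset.mem_powersetCard]
        exact ⟨h2, hcardE g hg⟩
    · rw [Finset.disjoint_left]
      exact fun e he he' => hleave e he' (hDE e he)
  · simp only [himg1, himg2]
    exact ⟨fun e he => mem_edgesAt.1 (edgesAt_mono ht2 ω (hDE e he)),
      fun e he h => hleave e he (edgesAt_mono h1t ω (mem_edgesAt.2 h))⟩

theorem processLaw_gapEvent_le {k m₁ m₂ : ℕ} (hd : 2 ≤ d) (hkn : k < n) (h12 : m₁ ≤ m₂)
    (hm : 2 * m₂ ≤ n.choose d) (hk : k ≤ m₁) :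
    (processLaw n d).toOuterMeasure (gapEvent n d k m₁ m₂) ≤
      ENNReal.ofReal (∑ s ∈ Finset.range k, ∑ a ∈ Finset.Icc 1 (n / 2),
        obstructionBound n d m₁ m₂ a s) := by
  have hnn : ∀ a s, 0 ≤ obstructionBound n d m₁ m₂ a s := fun a s => by
    rw [obstructionBound]; positivity
  rw [ENNReal.ofReal_sum_of_nonneg fun s _ => Finset.sum_nonneg fun a _ => hnn a s]
  refine (MeasureTheory.measure_mono (gapEvent_subset hd hkn)).trans ?_
  refine (MeasureTheory.measure_biUnion_finset_le _ _).trans (Finset.sum_le_sum fun s hs => ?_)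
  rw [ENNReal.ofReal_sum_of_nonneg fun a _ => hnn a s]
  refine (MeasureTheory.measure_biUnion_finset_le _ _).trans (Finset.sum_le_sum fun a _ => ?_)
  refine (MeasureTheory.measure_biUnion_finset_le _ _).trans ?_
  have hs' := Finset.mem_range.1 hs
  refine (Finset.sum_le_sum fun A hA => (processLaw_obstruction_le (by omega) h12 hm
    (by omega) A).trans_eq (by rw [(Finset.mem_powersetCard.1 hA).2])).trans ?_
  rw [Finset.sum_const, Finset.card_powersetCard, Finset.card_univ, Fintype.card_fin,
    nsmul_eq_mul, ← ENNReal.ofReal_natCast, ← ENNReal.ofReal_mul (by positivity)]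
  refine ENNReal.ofReal_le_ofReal (le_of_eq ?_)
  rw [obstructionBound]
  ring

/-- The event that the process does not have minimum degree at least `k` at time `m`. -/
def lowDegreeEvent (n d k m : ℕ) : Set (List (Finset (Fin n))) :=
  {ω | (∀ e ∈ ω, e.card = d) ∧ ¬ (process n m ω).MinDegreeAtLeast k}

/-- A vertex `v` of low degree has a hitting set `T` of `k - 1` vertices, so no edge at `v` avoids
`T`. There are at most `n ^ k` pairs `(v, T)`. -/
theorem processLaw_lowDegreeEvent_le {k m : ℕ} (hd : 2 ≤ d) (hk : 1 ≤ k) (hkn : k ≤ n)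
    (hm : 2 * m ≤ n.choose d) :
    (processLaw n d).toOuterMeasure (lowDegreeEvent n d k m) ≤
      ENNReal.ofReal ((n : ℝ) ^ k *
        Real.exp (-((((n - 1 - (k - 1)).choose (d - 1) : ℕ) : ℝ) / n.choose d) * m)) := by
  classical
  have hsub : lowDegreeEvent n d k m ⊆ ⋃ v ∈ (Finset.univ : Finset (Fin n)),
      ⋃ T ∈ (Finset.powersetCard (k - 1) Finset.univ).filter (v ∉ ·),
        obstructionEvent n d m m {v} T ∅ := by
    rintro ω ⟨hω, h⟩
    rw [minDegreeAtLeast_process_iff] at h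
    push Not at h
    obtain ⟨v, hv⟩ := h
    have hcardE : ∀ e ∈ edgesAt n m ω, 2 ≤ e.card := fun e he =>
      (hω e (List.mem_of_mem_take (mem_edgesAt.1 he))).symm ▸ hd
    obtain ⟨T, hT, hvT, hhit⟩ := exists_hitting_set hkn hcardE hv
    simp only [Set.mem_iUnion]
    refine ⟨v, Finset.mem_univ _, T, ?_, by simp, ?_⟩
    · rw [Finset.mem_filter, Finset.mem_powersetCard]
      exact ⟨⟨Finset.subset_univ _, by omega⟩, hvT⟩
    · intro e he heω
      rw [edgesLeaving, Finset.mem_filter] at he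
      obtain ⟨x, hx⟩ := Finset.card_eq_one.1 he.2.2
      have hx' : x ∈ e ∩ {v} := by rw [hx]; simp
      rw [Finset.mem_inter, Finset.mem_singleton] at hx'
      exact hhit e (mem_edgesAt.2 heω) (hx'.2 ▸ hx'.1) he.2.1
  have hterm : ∀ v : Fin n, ∀ T ∈ (Finset.powersetCard (k - 1) Finset.univ).filter (v ∉ ·),
      (processLaw n d).toOuterMeasure (obstructionEvent n d m m {v} T ∅) ≤
      ENNReal.ofReal
        (Real.exp (-((((n - 1 - (k - 1)).choose (d - 1) : ℕ) : ℝ) / n.choose d) * m)) := by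
    intro v T hT
    rw [Finset.mem_filter, Finset.mem_powersetCard] at hT
    refine (processLaw_present_absent_le le_rfl hm ∅ (edgesLeaving n d {v} T)
      (Finset.filter_subset _ _) (Finset.disjoint_empty_left _)).trans
      (ENNReal.ofReal_le_ofReal ?_)
    have hF := le_card_edgesLeaving (n := n) (by omega : 1 ≤ d) (A := {v}) (S := T)
    rw [Finset.sdiff_eq_self_of_disjoint (by simpa using hT.2), hT.1.2, Finset.card_singleton,
      one_mul] at hF
    rw [Finset.card_empty, pow_zero, one_mul, Nat.cast_zero, sub_zero]
    gcongr
  refine (MeasureTheory.measure_mono hsub).trans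
    ((MeasureTheory.measure_biUnion_finset_le _ _).trans
    ((Finset.sum_le_sum fun v _ => (MeasureTheory.measure_biUnion_finset_le _ _).trans
      (Finset.sum_le_sum (hterm v))).trans ?_))
  set x := Real.exp (-((((n - 1 - (k - 1)).choose (d - 1) : ℕ) : ℝ) / n.choose d) * m)
  have hcount : ∀ v : Fin n, ∑ T ∈ (Finset.powersetCard (k - 1) Finset.univ).filter (v ∉ ·),
      ENNReal.ofReal x ≤ ENNReal.ofReal ((n : ℝ) ^ (k - 1) * x) := by
    intro v
    rw [Finset.sum_const, nsmul_eq_mul, ENNReal.ofReal_mul (by positivity)]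
    gcongr
    rw [← ENNReal.ofReal_natCast]
    refine ENNReal.ofReal_le_ofReal ?_
    have h1 := Finset.card_filter_le
      (Finset.powersetCard (k - 1) (Finset.univ : Finset (Fin n))) (v ∉ ·)
    rw [Finset.card_powersetCard, Finset.card_univ, Fintype.card_fin] at h1
    exact_mod_cast h1.trans (Nat.choose_le_pow n (k - 1))
  refine (Finset.sum_le_sum fun v _ => hcount v).trans_eq ?_
  rw [Finset.sum_const, Finset.card_univ, Fintype.card_fin, nsmul_eq_mul,
    ← ENNReal.ofReal_natCast, ← ENNReal.ofReal_mul (by positivity), ← mul_assoc, ← pow_succ',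
    Nat.sub_add_cancel hk]

end RandomHypergraph

/-! ### The time window and the cost of the small side -/

namespace RandomHypergraph

theorem eventually_mul_log_pow_le (C : ℝ) (j : ℕ) :
    ∀ᶠ n : ℕ in atTop, C * Real.log n ^ j ≤ n := by
  have h := (Real.isLittleO_pow_log_id_atTop (n := j)).comp_tendsto (tendsto_natCast_atTop_atTop (R := ℝ))
  have hC : 0 < 1 / (|C| + 1) := by positivity
  filter_upwards [h.bound hC] with n hn
  simp only [Function.comp_apply, id, Real.norm_eq_abs, Nat.abs_cast] at hn
  rw [div_mul_eq_mul_div, one_mul, le_div_iff₀ (by positivity)] at hn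
  calc C * Real.log n ^ j ≤ |C * Real.log n ^ j| := le_abs_self _
    _ = |Real.log n ^ j| * |C| := by rw [abs_mul, mul_comm]
    _ ≤ |Real.log n ^ j| * (|C| + 1) := by gcongr; linarith
    _ ≤ n := hn

theorem eventually_le_log (C : ℝ) : ∀ᶠ n : ℕ in atTop, C ≤ Real.log n :=
  (Real.tendsto_log_atTop.comp (tendsto_natCast_atTop_atTop (R := ℝ))).eventually_ge_atTop C

/-- The time shortly before the minimum degree becomes positive. -/
noncomputable def lowerTime (n d : ℕ) : ℕ :=
  ⌊(n : ℝ) / d * (Real.log n - Real.log (Real.log n) / 2)⌋₊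

/-- A time by which the minimum degree is at least `k`. -/
noncomputable def upperTime (n d k : ℕ) : ℕ := ⌈(4 : ℝ) ^ d * (k + 1) * (n * Real.log n)⌉₊

theorem lowerTime_le {n d : ℕ} (hL : 1 ≤ Real.log n) :
    (lowerTime n d : ℝ) ≤ n / d * (Real.log n - Real.log (Real.log n) / 2) := by
  refine Nat.floor_le (mul_nonneg (by positivity) ?_)
  have := Real.log_le_sub_one_of_pos (by linarith : 0 < Real.log n)
  linarith

theorem le_upperTime (n d k : ℕ) :
    (4 : ℝ) ^ d * (k + 1) * (n * Real.log n) ≤ upperTime n d k := Nat.le_ceil _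

theorem upperTime_le {n d k : ℕ} (hn : 1 ≤ n) (hL : 1 ≤ Real.log n) :
    (upperTime n d k : ℝ) ≤ ((4 : ℝ) ^ d * (k + 1) + 1) * (n * Real.log n) := by
  have h := (Nat.ceil_lt_add_one (a := (4 : ℝ) ^ d * (k + 1) * (n * Real.log n))
    (by positivity)).le
  have hn' : (1 : ℝ) ≤ n := by exact_mod_cast hn
  rw [upperTime]
  nlinarith

/-- Rounding and the `s + 1` prescribed positions lose at most `k + 1 ≤ n / d`, hence only `1`
inside the bracket. -/
theorem lowerTime_sub_ge {n d k s : ℕ} (hd : 1 ≤ d) (hs : s < k) (hkn : d * (k + 1) ≤ n) :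
    (n : ℝ) / d * (Real.log n - Real.log (Real.log n) / 2 - 1) ≤
      (lowerTime n d : ℝ) - (s + 1 : ℕ) := by
  have h := (Nat.lt_floor_add_one
    ((n : ℝ) / d * (Real.log n - Real.log (Real.log n) / 2))).le
  have h1 : ((s + 1 : ℕ) : ℝ) + 1 ≤ k + 1 := by exact_mod_cast (by omega)
  have h2 : (k : ℝ) + 1 ≤ n / d := by
    rw [le_div_iff₀ (by positivity)]
    exact_mod_cast (by rw [mul_comm]; exact hkn)
  rw [lowerTime]
  linarith

theorem choose_mul_eq {n d : ℕ} (hn : 1 ≤ n) (hd : 1 ≤ d) :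
    (n : ℝ) * (n - 1).choose (d - 1) = n.choose d * d := by
  obtain ⟨m, rfl⟩ := Nat.exists_eq_add_of_le' hn
  obtain ⟨e, rfl⟩ := Nat.exists_eq_add_of_le' hd
  exact_mod_cast Nat.add_one_mul_choose_eq m e

/-- A lower bound for the proportion of edges at a vertex that avoid `b` other vertices. -/
theorem choose_ratio_ge {n d b : ℕ} (hd : 1 ≤ d) (hb : b + d ≤ n) :
    (d : ℝ) / n * (((n : ℝ) - b - d) / n) ^ (d - 1) ≤
      ((n - b).choose (d - 1) : ℝ) / n.choose d := by
  have hn : (0 : ℝ) < n := by exact_mod_cast (by omega)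
  have hN : (0 : ℝ) < n.choose d := by exact_mod_cast Nat.choose_pos (by omega)
  have h1 := choose_mul_eq (n := n) (d := d) (by omega) hd
  have h2 : ((n - 1).choose (d - 1) : ℝ) ≤ (n : ℝ) ^ (d - 1) / (d - 1).factorial := by
    refine (Nat.choose_le_pow_div (d - 1) (n - 1)).trans ?_
    gcongr
    exact_mod_cast Nat.sub_le n 1
  have h3 : ((n : ℝ) - b - d) ^ (d - 1) / (d - 1).factorial ≤ (n - b).choose (d - 1) := by
    refine le_trans ?_ (Nat.pow_le_choose (d - 1) (n - b))
    have : (0 : ℝ) ≤ (n : ℝ) - b - d := by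
      have : ((b + d : ℕ) : ℝ) ≤ n := by exact_mod_cast hb
      push_cast at this
      linarith
    gcongr
    have : (n : ℝ) = ((n - b - d : ℕ) : ℝ) + b + d := by
      exact_mod_cast (by omega : n = n - b - d + b + d)
    rw [this]
    have : ((n - b - d : ℕ) : ℝ) ≤ ((n - b + 1 - (d - 1) : ℕ) : ℝ) := by
      exact_mod_cast (by omega)
    linarith
  rw [le_div_iff₀ hN, div_pow]
  set f : ℝ := ((d - 1).factorial : ℝ)
  have hf : 0 < f := by simp only [f]; exact_mod_cast Nat.factorial_pos _
  have hx : 0 ≤ ((n : ℝ) - b - d) ^ (d - 1) := by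
    apply pow_nonneg
    have : ((b + d : ℕ) : ℝ) ≤ n := by exact_mod_cast hb
    push_cast at this
    linarith
  calc (d : ℝ) / n * (((n : ℝ) - b - d) ^ (d - 1) / (n : ℝ) ^ (d - 1)) * n.choose d
      = ((n : ℝ) - b - d) ^ (d - 1) / (n : ℝ) ^ (d - 1) * (n.choose d * d / n) := by ring
    _ = ((n : ℝ) - b - d) ^ (d - 1) / (n : ℝ) ^ (d - 1) * (n - 1).choose (d - 1) := by
        rw [← h1]; field_simp
    _ ≤ ((n : ℝ) - b - d) ^ (d - 1) / (n : ℝ) ^ (d - 1) * ((n : ℝ) ^ (d - 1) / f) := by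
        gcongr
    _ = ((n : ℝ) - b - d) ^ (d - 1) / f := by field_simp
    _ ≤ _ := h3

/-- From `a ^ q / q! ≤ exp a`: a polynomial factor becomes a constant to the power `a`, which merges
with the other `a`-th powers. -/
theorem pow_le_factorial_mul_exp (a q : ℕ) (ha : 1 ≤ a) :
    (a : ℝ) ^ q ≤ ((q.factorial : ℝ) * Real.exp 1) ^ a := by
  have hq : (1 : ℝ) ≤ q.factorial := by exact_mod_cast Nat.factorial_pos q
  have h := Real.pow_div_factorial_le_exp (x := a) (by positivity) q
  rw [div_le_iff₀ (by positivity)] at h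
  calc (a : ℝ) ^ q ≤ Real.exp a * q.factorial := h
    _ ≤ Real.exp a * (q.factorial : ℝ) ^ a := by
      gcongr
      exact le_self_pow₀ hq (by omega)
    _ = _ := by rw [mul_pow, ← Real.exp_nat_mul, mul_one, mul_comm]

/-- The union bound over small sides with at most `n / log n` vertices. -/
theorem small_side_bound {n a q : ℕ} {c z : ℝ} (ha : 1 ≤ a) (hL : 1 ≤ Real.log n)
    (hz : Real.log n - Real.log (Real.log n) / 2 - c ≤ z) :
    (n.choose a : ℝ) * (a : ℝ) ^ q * Real.exp (-(a * z)) ≤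
      Real.exp (q.factorial * Real.exp (1 + c) * √(Real.log n)) := by
  have hn : (0 : ℝ) < n := by
    rcases Nat.eq_zero_or_pos n with rfl | h
    · simp at hL; linarith
    · exact_mod_cast h
  have hL0 : 0 < Real.log n := by linarith
  have h1 : Real.exp (-(a * z)) ≤ (Real.exp c * √(Real.log n) / n) ^ a := by
    have : Real.exp c * √(Real.log n) / n =
        Real.exp (-(Real.log n - Real.log (Real.log n) / 2 - c)) := by
      rw [show -(Real.log n - Real.log (Real.log n) / 2 - c) =
        c + Real.log (Real.log n) / 2 - Real.log n by ring, Real.exp_sub, Real.exp_add,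
        Real.exp_log hn, Real.exp_half, Real.exp_log hL0]
    rw [this, ← Real.exp_nat_mul]
    refine Real.exp_le_exp.2 ?_
    have : (0 : ℝ) ≤ a := by positivity
    nlinarith
  calc (n.choose a : ℝ) * (a : ℝ) ^ q * Real.exp (-(a * z))
      ≤ ((n : ℝ) ^ a / a.factorial) * ((q.factorial : ℝ) * Real.exp 1) ^ a *
        (Real.exp c * √(Real.log n) / n) ^ a := by
        gcongr
        · exact Nat.choose_le_pow_div a n
        · exact pow_le_factorial_mul_exp a q ha
    -- The powers of `n` cancel, leaving one term of an exponential series.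
    _ = (q.factorial * Real.exp (1 + c) * √(Real.log n)) ^ a / a.factorial := by
      rw [div_mul_eq_mul_div, div_mul_eq_mul_div, ← mul_pow, ← mul_pow, Real.exp_add]
      congr 2
      field_simp
    _ ≤ _ := Real.pow_div_factorial_le_exp _ (by positivity) a

/-- The union bound over small sides with more than `n / log n` vertices. -/
theorem large_side_bound {n a q : ℕ} {c z : ℝ} (ha : 1 ≤ a) (hL : 1 ≤ Real.log n)
    (haL : (n : ℝ) ≤ a * Real.log n) (hz : c * Real.log n ≤ z)
    (hc : q.factorial * Real.exp 1 * Real.exp 1 * Real.log n ≤ Real.exp (c * Real.log n)) :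
    (n.choose a : ℝ) * (a : ℝ) ^ q * Real.exp (-(a * z)) ≤ 1 := by
  have hL0 : 0 < Real.log n := by linarith
  have h1 : Real.exp (-(a * z)) ≤ (Real.exp (c * Real.log n))⁻¹ ^ a := by
    rw [← Real.exp_neg, ← Real.exp_nat_mul]
    refine Real.exp_le_exp.2 ?_
    have : (0 : ℝ) ≤ a := by positivity
    nlinarith
  -- Since `n ≤ a * log n`, the number of sets `A` is only polylogarithmic per vertex of `A`.
  have h2 : (n.choose a : ℝ) ≤ (Real.exp 1 * Real.log n) ^ a := by
    calc (n.choose a : ℝ) ≤ (n : ℝ) ^ a / a.factorial := Nat.choose_le_pow_div a n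
      _ ≤ (a * Real.log n) ^ a / a.factorial := by gcongr
      _ = (a : ℝ) ^ a / a.factorial * Real.log n ^ a := by rw [mul_pow]; ring
      _ ≤ Real.exp a * Real.log n ^ a := by
        gcongr
        exact Real.pow_div_factorial_le_exp _ (by positivity) a
      _ = _ := by rw [mul_pow, ← Real.exp_nat_mul, mul_one]
  calc (n.choose a : ℝ) * (a : ℝ) ^ q * Real.exp (-(a * z))
      ≤ (Real.exp 1 * Real.log n) ^ a * ((q.factorial : ℝ) * Real.exp 1) ^ a *
        (Real.exp (c * Real.log n))⁻¹ ^ a := by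
        gcongr
        exact pow_le_factorial_mul_exp a q ha
    _ = ((q.factorial * Real.exp 1 * Real.exp 1 * Real.log n) / Real.exp (c * Real.log n)) ^ a := by
      rw [← mul_pow, ← mul_pow]
      congr 1
      ring
    _ ≤ 1 := by
      refine pow_le_one₀ (by positivity) ?_
      rw [div_le_one (by positivity)]
      exact hc

/-- For `a ≤ n / log n` almost all edges at a vertex of `A` leave, and the exponent per vertex is
`log n - log (log n) / 2 - O(1)`. For larger `a` a constant proportion leaves, so the exponent is a
constant times `log n`, which suffices because there are few sets per vertex. -/
theorem eventually_side_bound (d k q : ℕ) (hd : 1 ≤ d) :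
    ∀ᶠ n : ℕ in atTop, ∀ s < k, ∀ a ∈ Finset.Icc 1 (n / 2),
      (n.choose a : ℝ) * (a : ℝ) ^ q *
        Real.exp (-(((a * (n - a - s).choose (d - 1) : ℕ) : ℝ) / n.choose d) *
          ((lowerTime n d : ℝ) - (s + 1 : ℕ))) ≤
      Real.exp (q.factorial * Real.exp (1 + (2 * d + 1)) * √(Real.log n)) := by
  set c₀ : ℝ := (1 / 4) ^ d with hc₀
  have hc₀pos : 0 < c₀ := by positivity
  filter_upwards [eventually_le_log 2, eventually_le_log (2 * d),
    eventually_le_log (2 * (q.factorial * Real.exp 1 * Real.exp 1) / c₀ ^ 2),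
    eventually_mul_log_pow_le (k + d) 1, eventually_ge_atTop (d * (k + 1)),
    eventually_ge_atTop (4 * (k + d))] with n hL2 hLd hLc hnL hnk hnk4
  intro s hs a ha
  rw [Finset.mem_Icc] at ha
  obtain ⟨ha1, ha2⟩ := ha
  set L := Real.log n with hL
  have hn : (0 : ℝ) < n := by
    have : 0 < n := by omega
    exact_mod_cast this
  have hd0 : (0 : ℝ) < d := by exact_mod_cast hd
  have hratio := choose_ratio_ge (n := n) (d := d) (b := a + s) hd (by omega)
  rw [← Nat.sub_sub] at hratio
  set y : ℝ := ((n - a - s).choose (d - 1) : ℝ) / n.choose d with hy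
  have hT := lowerTime_sub_ge (n := n) (d := d) hd hs hnk
  set T : ℝ := (lowerTime n d : ℝ) - (s + 1 : ℕ) with hTdef
  have hloglog : Real.log L ≤ L - 1 := Real.log_le_sub_one_of_pos (by linarith)
  have hloglog0 : 0 ≤ Real.log L := Real.log_nonneg (by linarith)
  set R : ℝ := L - Real.log L / 2 - 1 with hR
  have hR4 : L / 4 ≤ R := by simp only [hR]; linarith
  have hRL : R ≤ L := by simp only [hR]; linarith
  have hexp : -(((a * (n - a - s).choose (d - 1) : ℕ) : ℝ) / n.choose d) * T = -(a * (y * T)) := by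
    rw [hy]; push_cast; ring
  rw [hexp]
  set ρ : ℝ := ((n : ℝ) - (a + s : ℕ) - d) / n with hρ
  have hprod : ρ ^ (d - 1) * R ≤ y * T := by
    have hρ0 : 0 ≤ ρ := by
      rw [hρ]
      refine div_nonneg ?_ hn.le
      have : ((a + s + d : ℕ) : ℝ) ≤ n := by exact_mod_cast (by omega)
      push_cast at this ⊢
      linarith
    calc ρ ^ (d - 1) * R = (d / n * ρ ^ (d - 1)) * (n / d * R) := by field_simp
      _ ≤ y * T := mul_le_mul hratio hT (mul_nonneg (by positivity) (by linarith))
        (by positivity)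
  rcases le_total ((a : ℝ) * L) n with haL | haL
  -- `2 * d` pays for Bernoulli's inequality, `1` for the loss at the lower time.
  · refine small_side_bound (c := 2 * d + 1) ha1 (by linarith) ?_
    refine le_trans ?_ hprod
    have hρ1 : 1 - 2 / L ≤ ρ := by
      rw [hρ, le_div_iff₀ hn, sub_mul, one_mul, div_mul_eq_mul_div]
      have h1 : ((a + s : ℕ) : ℝ) + d ≤ a + (k + d) := by
        push_cast
        have : (s : ℝ) ≤ k := by exact_mod_cast hs.le
        linarith
      have h2 : (a : ℝ) ≤ n / L := by rw [le_div_iff₀ (by linarith)]; exact haL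
      have h3 : (k : ℝ) + d ≤ n / L := by
        rw [le_div_iff₀ (by linarith)]; simpa using hnL
      have h4 : 2 * (n : ℝ) / L = n / L + n / L := by ring
      linarith
    have h2L : 2 / L ≤ 1 := by rw [div_le_one (by linarith)]; exact hL2
    have hbern : 1 - 2 * d / L ≤ ρ ^ (d - 1) := by
      have h1 := one_add_mul_le_pow (a := -(2 / L)) (by linarith) (d - 1)
      have h2 : (1 + -(2 / L)) ^ (d - 1) ≤ ρ ^ (d - 1) :=
        pow_le_pow_left₀ (by linarith) (by linarith) _
      have h3 : ((d - 1 : ℕ) : ℝ) * (2 / L) ≤ d * (2 / L) := by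
        gcongr
        exact_mod_cast Nat.sub_le d 1
      have h4 : 2 * (d : ℝ) / L = d * (2 / L) := by ring
      linarith
    have h5 : (1 - 2 * d / L) * R ≤ ρ ^ (d - 1) * R :=
      mul_le_mul_of_nonneg_right hbern (by linarith)
    have h6 : 2 * d / L * R ≤ 2 * d := by
      calc 2 * d / L * R ≤ 2 * d / L * L := by gcongr
        _ = 2 * d := by field_simp
    simp only [hR] at h5 h6 ⊢
    linarith
  · refine (large_side_bound (c := c₀) ha1 (by linarith) haL ?_ ?_).trans
      (Real.one_le_exp (by positivity))
    · refine le_trans ?_ hprod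
      have hρ4 : 1 / 4 ≤ ρ := by
        rw [hρ, le_div_iff₀ hn]
        have : ((4 * (a + s) + 4 * d + n : ℕ) : ℝ) ≤ ((4 * n : ℕ) : ℝ) := by
          exact_mod_cast (by omega)
        push_cast at this ⊢
        linarith
      calc c₀ * L = (1 / 4) ^ (d - 1) * (L / 4) := by
            rw [hc₀, ← Nat.sub_add_cancel hd, pow_succ]
            simp only [Nat.add_sub_cancel]
            ring
        _ ≤ ρ ^ (d - 1) * R := by gcongr
    -- The quadratic term of the exponential beats the required linear one once `L` is large.
    · have h1 := Real.quadratic_le_exp_of_nonneg (x := c₀ * L) (by positivity)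
      rw [div_le_iff₀ (by positivity)] at hLc
      have : 0 ≤ c₀ * L := by positivity
      nlinarith

end RandomHypergraph

/-! ### Vanishing of the obstruction and low-degree probabilities -/

namespace RandomHypergraph

theorem choose_ge_pow_div {n d : ℕ} (hn : 2 * d ≤ n) :
    ((n : ℝ) / 2) ^ d / d.factorial ≤ n.choose d := by
  refine le_trans ?_ (Nat.pow_le_choose d n)
  gcongr
  rw [div_le_iff₀ two_pos]
  exact_mod_cast (by omega : n ≤ (n + 1 - d) * 2)

theorem choose_ge_cube {n d : ℕ} (hd : 3 ≤ d) (hn : 2 * d ≤ n) :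
    (n : ℝ) ^ 3 / (8 * d.factorial) ≤ n.choose d := by
  refine le_trans ?_ (choose_ge_pow_div hn)
  have h1 : (1 : ℝ) ≤ n / 2 := by
    rw [le_div_iff₀ two_pos]; exact_mod_cast (by omega)
  calc (n : ℝ) ^ 3 / (8 * d.factorial) = (n / 2) ^ 3 / d.factorial := by
        field_simp; norm_num
    _ ≤ _ := by gcongr

theorem eventually_mul_log_le_choose (C : ℝ) (j d : ℕ) (hd : 3 ≤ d) :
    ∀ᶠ n : ℕ in atTop, C * ((n : ℝ) * Real.log n ^ j) ≤ (n - 2).choose d := by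
  filter_upwards [eventually_mul_log_pow_le (C * (64 * d.factorial)) j,
    eventually_ge_atTop (2 * d + 4)] with n h1 hn
  refine le_trans ?_ (choose_ge_cube hd (by omega))
  have hf : (0 : ℝ) < d.factorial := by exact_mod_cast Nat.factorial_pos d
  have h2 : (n : ℝ) / 2 ≤ ((n - 2 : ℕ) : ℝ) := by
    rw [div_le_iff₀ two_pos]; exact_mod_cast (by omega : n ≤ (n - 2) * 2)
  have hn1 : (1 : ℝ) ≤ n := by exact_mod_cast (by omega)
  calc C * ((n : ℝ) * Real.log n ^ j)
      = (C * (64 * d.factorial) * Real.log n ^ j) * n / (64 * d.factorial) := by field_simp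
    _ ≤ n * n / (64 * d.factorial) := by gcongr
    _ ≤ (n : ℝ) ^ 3 / (64 * d.factorial) := by
        gcongr
        nlinarith
    _ = ((n : ℝ) / 2) ^ 3 / (8 * d.factorial) := by field_simp; norm_num
    _ ≤ _ := by gcongr

theorem choose_two_mul_eq {n d : ℕ} (hn : 2 ≤ n) (hd : 2 ≤ d) :
    ((n : ℝ) * (n - 1)) * (n - 2).choose (d - 2) = n.choose d * (d * (d - 1)) := by
  have h1 := choose_mul_eq (n := n) (d := d) (by omega) (by omega)
  have h2 := choose_mul_eq (n := n - 1) (d := d - 1) (by omega) (by omega)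
  rw [Nat.sub_sub, Nat.sub_sub, Nat.cast_sub (by omega), Nat.cast_sub (by omega),
    Nat.cast_one] at h2
  calc _ = (n : ℝ) * ((n - 1) * (n - 2).choose (d - 2)) := by ring
    _ = (n * (n - 1).choose (d - 1)) * (d - 1) := by rw [h2]; ring
    _ = _ := by rw [h1]; ring

/-- The gain from the extra edge. A proportion `O(n ^ (-2))` of all edges contains two given
vertices; a proportion at most `(2 a / n) ^ d ≤ (2 a / n) ^ 3` lies inside `A`. The exponent `3`,
available as `d ≥ 3`, makes the weights sum to `O(1 / n)`. -/
theorem extraCount_mul_le {n d a s k : ℕ} {x : ℝ} (hd : 3 ≤ d) (hn : 2 * d ≤ n) (ha : 1 ≤ a)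
    (ha2 : 2 * a ≤ n) (hs : s < k) (hx : 0 ≤ x) :
    extraCount n d a s * (n * x / (n.choose d : ℝ)) ≤
      8 * k * d ^ 2 * x * a ^ 3 * ((if a = 1 then 1 / (n : ℝ) else 0) + 1 / (n : ℝ) ^ 2) := by
  have hn0 : (2 : ℝ) ≤ n := by exact_mod_cast (by omega)
  have hN : (0 : ℝ) < n.choose d := by exact_mod_cast Nat.choose_pos (by omega)
  have hk1 : (1 : ℝ) ≤ k := by exact_mod_cast (by omega)
  have hd1 : (1 : ℝ) ≤ d := by exact_mod_cast (by omega)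
  have ha1 : (1 : ℝ) ≤ a := by exact_mod_cast ha
  have hsk : (s : ℝ) ≤ k := by exact_mod_cast hs.le
  rw [extraCount]
  split_ifs with h
  · subst h
    have h1 := choose_two_mul_eq (n := n) (d := d) (by omega) (by omega)
    have h2 : ((n - 2).choose (d - 2) : ℝ) / n.choose d ≤ 2 * d ^ 2 / n ^ 2 := by
      rw [div_le_div_iff₀ hN (by positivity)]
      set u : ℝ := ((n - 2).choose (d - 2) : ℝ)
      have hu : 0 ≤ u := by positivity
      calc u * (n : ℝ) ^ 2 ≤ u * (2 * (n * (n - 1))) := by gcongr; nlinarith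
        _ = 2 * (n.choose d * (d * (d - 1))) := by rw [← h1]; ring
        _ ≤ 2 * (n.choose d * (d * d)) := by gcongr; linarith
        _ = _ := by ring
    calc ((s * (n - 2).choose (d - 2) : ℕ) : ℝ) * (n * x / (n.choose d : ℝ))
        = s * (n * x) * (((n - 2).choose (d - 2) : ℝ) / n.choose d) := by push_cast; ring
      _ ≤ k * (n * x) * (2 * d ^ 2 / n ^ 2) := by gcongr
      _ = 2 * k * d ^ 2 * x * (1 / n) := by field_simp
      _ ≤ 8 * k * d ^ 2 * x * (1 / n + 1 / (n : ℝ) ^ 2) := by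
        gcongr
        · norm_num
        · exact le_add_of_nonneg_right (by positivity)
      _ = _ := by simp
  · have h1 : (a.choose d : ℝ) / n.choose d ≤ (2 * a / n) ^ 3 := by
      have h2 := choose_ge_pow_div hn
      have h3 : (a.choose d : ℝ) ≤ a ^ d / d.factorial := Nat.choose_le_pow_div d a
      calc (a.choose d : ℝ) / n.choose d
          ≤ (a ^ d / d.factorial) / ((n / 2) ^ d / d.factorial) := by gcongr
        _ = (2 * a / n) ^ d := by
          rw [div_div_div_cancel_right₀ (by positivity), ← div_pow]
          congr 1
          field_simp
        _ ≤ (2 * a / n) ^ 3 := by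
          refine pow_le_pow_of_le_one (by positivity) ?_ hd
          rw [div_le_one (by positivity)]
          exact_mod_cast ha2
    calc (a.choose d : ℝ) * (n * x / (n.choose d : ℝ))
        = (n * x) * ((a.choose d : ℝ) / n.choose d) := by ring
      _ ≤ (n * x) * (2 * a / n) ^ 3 := by gcongr
      _ = 8 * 1 * 1 ^ 2 * x * a ^ 3 * (0 + 1 / (n : ℝ) ^ 2) := by field_simp; norm_num
      _ ≤ _ := by gcongr

/-- Each attached edge costs at most `d ^ 2 * M * a ≥ 1`, so `s` may be raised to `k`. The extra
edge adds `a ^ 3`, whence the exponent `k + 3`. -/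
theorem obstructionBound_le {n d k a s m₁ m₂ : ℕ} {M Q : ℝ} (hd : 3 ≤ d) (hn : 2 * d ≤ n)
    (ha : 1 ≤ a) (ha2 : 2 * a ≤ n) (hs : s < k) (hM : 1 ≤ M) (hm₂ : 2 * (m₂ : ℝ) ≤ n * M)
    (hQ : (n.choose a : ℝ) * (a : ℝ) ^ (k + 3) *
        Real.exp (-(((a * (n - a - s).choose (d - 1) : ℕ) : ℝ) / n.choose d) *
          ((m₁ : ℝ) - (s + 1 : ℕ))) ≤ Q) :
    obstructionBound n d m₁ m₂ a s ≤
      8 * k * d ^ 2 * M * (d ^ 2 * M) ^ k * Q *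
        ((if a = 1 then 1 / (n : ℝ) else 0) + 1 / (n : ℝ) ^ 2) := by
  have hn0 : (0 : ℝ) < n := by exact_mod_cast (by omega)
  have hN : (0 : ℝ) < n.choose d := by exact_mod_cast Nat.choose_pos (by omega)
  have hd1 : (1 : ℝ) ≤ d := by exact_mod_cast (by omega)
  have ha1 : (1 : ℝ) ≤ a := by exact_mod_cast ha
  have h1 := choose_mul_eq (n := n) (d := d) (by omega) (by omega)
  have h1' : ((n - 1).choose (d - 1) : ℝ) = n.choose d * d / n := by
    rw [← h1]; field_simp
  rw [obstructionBound]
  set E := Real.exp (-(((a * (n - a - s).choose (d - 1) : ℕ) : ℝ) / n.choose d) *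
          ((m₁ : ℝ) - (s + 1 : ℕ)))
  set w : ℝ := (if a = 1 then 1 / (n : ℝ) else 0) + 1 / (n : ℝ) ^ 2 with hw
  have hw0 : 0 ≤ w := by positivity
  have hflag : ((d * (a * (n - 1).choose (d - 1)) : ℕ) : ℝ) ^ s * (2 * m₂ / (n.choose d : ℝ)) ^ s ≤
      (d ^ 2 * M) ^ k * (a : ℝ) ^ k := by
    rw [← mul_pow, ← mul_pow]
    have h2 : ((d * (a * (n - 1).choose (d - 1)) : ℕ) : ℝ) * (2 * m₂ / (n.choose d : ℝ)) ≤
        d ^ 2 * M * a := by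
      push_cast
      rw [h1']
      calc (d : ℝ) * (a * (n.choose d * d / n)) * (2 * m₂ / n.choose d)
          = d ^ 2 * a * (2 * m₂) / n := by field_simp
        _ ≤ d ^ 2 * a * (n * M) / n := by gcongr
        _ = _ := by field_simp
    have h3 : (1 : ℝ) ≤ d ^ 2 * M * a :=
      one_le_mul_of_one_le_of_one_le (one_le_mul_of_one_le_of_one_le (one_le_pow₀ hd1) hM) ha1
    calc _ ≤ (d ^ 2 * M * a) ^ s := pow_le_pow_left₀ (by positivity) h2 s
      _ ≤ _ := pow_le_pow_right₀ h3 hs.le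
  have hextra : extraCount n d a s * (2 * m₂ / (n.choose d : ℝ)) ≤
      8 * k * d ^ 2 * M * a ^ 3 * w := by
    refine le_trans ?_ (extraCount_mul_le hd hn ha ha2 hs (by linarith : 0 ≤ M))
    gcongr
  calc _ = (((d * (a * (n - 1).choose (d - 1)) : ℕ) : ℝ) ^ s *
          (2 * m₂ / (n.choose d : ℝ)) ^ s) * (extraCount n d a s * (2 * m₂ / (n.choose d : ℝ))) *
          ((n.choose a : ℝ) * E) := by ring
    _ ≤ ((d ^ 2 * M) ^ k * (a : ℝ) ^ k) * (8 * k * d ^ 2 * M * a ^ 3 * w) *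
          ((n.choose a : ℝ) * E) := by gcongr
    _ = 8 * k * d ^ 2 * M * (d ^ 2 * M) ^ k * w * ((n.choose a : ℝ) * a ^ (k + 3) * E) := by ring
    _ ≤ 8 * k * d ^ 2 * M * (d ^ 2 * M) ^ k * w * Q := by gcongr
    _ = _ := by ring

theorem sum_weights_le (n : ℕ) (hn : 1 ≤ n) :
    ∑ a ∈ Finset.Icc 1 (n / 2), ((if a = 1 then 1 / (n : ℝ) else 0) + 1 / (n : ℝ) ^ 2) ≤
      2 / (n : ℝ) := by
  have hn0 : (0 : ℝ) < n := by exact_mod_cast hn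
  rw [Finset.sum_add_distrib, Finset.sum_ite_eq', Finset.sum_const, Nat.card_Icc, nsmul_eq_mul]
  have h1 : (if 1 ∈ Finset.Icc 1 (n / 2) then 1 / (n : ℝ) else 0) ≤ 1 / n := by
    split_ifs
    · exact le_rfl
    · positivity
  have h2 : ((n / 2 + 1 - 1 : ℕ) : ℝ) * (1 / (n : ℝ) ^ 2) ≤ 1 / n := by
    calc ((n / 2 + 1 - 1 : ℕ) : ℝ) * (1 / (n : ℝ) ^ 2) ≤ n * (1 / (n : ℝ) ^ 2) := by
          gcongr
          exact_mod_cast (by omega)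
      _ = _ := by field_simp
  calc _ ≤ 1 / (n : ℝ) + 1 / n := add_le_add h1 h2
    _ = _ := by ring

/-- With `u = √(log n)` one has `n = exp (u ^ 2)`, and `K u - u ^ 2 ≤ -u` once `u ≥ K + 1`. -/
theorem tendsto_log_pow_mul_exp_sqrt_log (K : ℝ) (j : ℕ) :
    Tendsto (fun n : ℕ => Real.log n ^ j * Real.exp (K * √(Real.log n)) / n) atTop (𝓝 0) := by
  have hu : Tendsto (fun n : ℕ => √(Real.log n)) atTop atTop :=
    Real.tendsto_sqrt_atTop.comp
      (Real.tendsto_log_atTop.comp (tendsto_natCast_atTop_atTop (R := ℝ)))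
  have h := (Real.tendsto_pow_mul_exp_neg_atTop_nhds_zero (2 * j)).comp hu
  refine squeeze_zero' (Eventually.of_forall fun n => ?_) ?_ h
  · have := Real.log_natCast_nonneg n
    positivity
  filter_upwards [hu.eventually_ge_atTop (K + 1), hu.eventually_ge_atTop 1,
    eventually_ge_atTop 1] with n h1 h2 hn
  have hn0 : (0 : ℝ) < n := by exact_mod_cast hn
  have hL := Real.log_natCast_nonneg n
  set u := √(Real.log n) with hudef
  have hu2 : Real.log n = u ^ 2 := (Real.sq_sqrt hL).symm
  have hnexp : (n : ℝ) = Real.exp (u ^ 2) := by rw [← hu2, Real.exp_log hn0]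
  simp only [Function.comp_apply]
  rw [← hudef, hu2, ← pow_mul, hnexp, mul_div_assoc, ← Real.exp_sub]
  gcongr
  nlinarith

theorem tendsto_gapEvent (d k : ℕ) (hd : 3 ≤ d) :
    Tendsto (fun n : ℕ => (processLaw n d).toOuterMeasure
      (gapEvent n d k (lowerTime n d) (upperTime n d k))) atTop (𝓝 0) := by
  set K : ℝ := (k + 3).factorial * Real.exp (1 + (2 * d + 1)) with hK
  -- Twice the constant in `upperTime_le`, so that `2 * m₂ ≤ n * (M * log n)`.
  set M : ℝ := 2 * ((4 : ℝ) ^ d * (k + 1) + 1) with hM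
  set B : ℝ := k * (8 * k * d ^ 2 * M * (d ^ 2 * M) ^ k) * 2 with hB
  have hM1 : 1 ≤ M := by
    have : (0 : ℝ) ≤ (4 : ℝ) ^ d * (k + 1) := by positivity
    linarith
  have hlim := (tendsto_log_pow_mul_exp_sqrt_log K (k + 1)).const_mul B
  rw [mul_zero] at hlim
  have hlim' := ENNReal.tendsto_ofReal hlim
  rw [ENNReal.ofReal_zero] at hlim'
  refine tendsto_of_tendsto_of_tendsto_of_le_of_le' tendsto_const_nhds hlim'
    (Eventually.of_forall fun n => zero_le) ?_
  filter_upwards [eventually_side_bound d k (k + 3) (by omega), eventually_le_log 2,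
    eventually_mul_log_le_choose M 1 d hd, eventually_ge_atTop (2 * d + k + 1),
    eventually_ge_atTop (d * (k + 1))] with n hside hL hch hn hnk
  have hn0 : (0 : ℝ) < n := by exact_mod_cast (by omega)
  have hup := upperTime_le (d := d) (k := k) (by omega : 1 ≤ n) (by linarith)
  have hL0 : 0 < Real.log n := by linarith
  have hll0 : 0 ≤ Real.log (Real.log n) := Real.log_nonneg (by linarith)
  have hll := Real.log_le_sub_one_of_pos hL0
  have hd1 : (1 : ℝ) ≤ d := by exact_mod_cast (by omega)
  have h12 : lowerTime n d ≤ upperTime n d k := by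
    have h1 := lowerTime_le (d := d) (by linarith : 1 ≤ Real.log n)
    have h2 := le_upperTime n d k
    have h3 : (n : ℝ) / d * (Real.log n - Real.log (Real.log n) / 2) ≤ n * Real.log n := by
      exact mul_le_mul (div_le_self hn0.le hd1) (by linarith) (by linarith) hn0.le
    have h4 : (1 : ℝ) ≤ (4 : ℝ) ^ d * (k + 1) :=
      one_le_mul_of_one_le_of_one_le (one_le_pow₀ (by norm_num)) (by linarith [k.cast_nonneg (α := ℝ)])
    have h5 : 1 * (n * Real.log n) ≤ (4 : ℝ) ^ d * (k + 1) * (n * Real.log n) := by gcongr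
    have : (lowerTime n d : ℝ) ≤ upperTime n d k := by linarith
    exact_mod_cast this
  have hm2 : 2 * (upperTime n d k : ℝ) ≤ n * (M * Real.log n) := by
    rw [hM]; linarith
  have hm : 2 * upperTime n d k ≤ n.choose d := by
    have h1 : ((n - 2).choose d : ℝ) ≤ n.choose d := by
      exact_mod_cast Nat.choose_le_choose d (Nat.sub_le n 2)
    have : 2 * (upperTime n d k : ℝ) ≤ n.choose d := by
      rw [pow_one] at hch; linarith
    exact_mod_cast this
  have hk : k ≤ lowerTime n d := by
    rcases Nat.eq_zero_or_pos k with rfl | hkpos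
    · exact Nat.zero_le _
    have h1 := lowerTime_sub_ge (n := n) (d := d) (s := k - 1) (by omega)
      (by omega : k - 1 < k) hnk
    rw [Nat.sub_add_cancel hkpos] at h1
    have h2 : 0 ≤ (n : ℝ) / d * (Real.log n - Real.log (Real.log n) / 2 - 1) :=
      mul_nonneg (by positivity) (by linarith)
    have : (k : ℝ) ≤ lowerTime n d := by linarith
    exact_mod_cast this
  refine (processLaw_gapEvent_le (by omega) (by omega) h12 hm hk).trans
    (ENNReal.ofReal_le_ofReal ?_)
  set Q := Real.exp (K * √(Real.log n)) with hQ
  set ML := M * Real.log n with hML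
  have hML1 : 1 ≤ ML := one_le_mul_of_one_le_of_one_le hM1 (by linarith)
  calc ∑ s ∈ Finset.range k, ∑ a ∈ Finset.Icc 1 (n / 2),
        obstructionBound n d (lowerTime n d) (upperTime n d k) a s
      ≤ ∑ s ∈ Finset.range k, 8 * k * d ^ 2 * ML * (d ^ 2 * ML) ^ k * Q * (2 / n) := by
        refine Finset.sum_le_sum fun s hs => ?_
        have hs' := Finset.mem_range.1 hs
        calc _ ≤ ∑ a ∈ Finset.Icc 1 (n / 2), 8 * k * d ^ 2 * ML * (d ^ 2 * ML) ^ k * Q *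
                ((if a = 1 then 1 / (n : ℝ) else 0) + 1 / (n : ℝ) ^ 2) := by
              refine Finset.sum_le_sum fun a ha => ?_
              have ha' := Finset.mem_Icc.1 ha
              exact obstructionBound_le hd (by omega) ha'.1 (by omega) hs' hML1 hm2
                (hside s hs' a ha)
          _ ≤ _ := by
              rw [← Finset.mul_sum]
              gcongr
              exact sum_weights_le n (by omega)
    _ = B * (Real.log n ^ (k + 1) * Q / n) := by
      rw [Finset.sum_const, Finset.card_range, nsmul_eq_mul, hB, hML,
        show (d : ℝ) ^ 2 * (M * Real.log n) = d ^ 2 * M * Real.log n by ring, mul_pow, pow_succ]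
      ring

/-- A proportion of at least `(1 / 4) ^ (d - 1) / n` of all edges leaves a given vertex. The factor
`4 ^ d * (k + 1)` in the upper time makes the exponent at least `(k + 1) * log n`, which beats the
`n ^ k` choices. -/
theorem tendsto_lowDegreeEvent (d k : ℕ) (hd : 3 ≤ d) (hk : 1 ≤ k) :
    Tendsto (fun n : ℕ => (processLaw n d).toOuterMeasure
      (lowDegreeEvent n d k (upperTime n d k))) atTop (𝓝 0) := by
  have hlim : Tendsto (fun n : ℕ => ENNReal.ofReal (1 / (n : ℝ))) atTop (𝓝 0) := by
    have := ENNReal.tendsto_ofReal (tendsto_one_div_atTop_nhds_zero_nat (𝕜 := ℝ))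
    rwa [ENNReal.ofReal_zero] at this
  refine tendsto_of_tendsto_of_tendsto_of_le_of_le' tendsto_const_nhds hlim
    (Eventually.of_forall fun n => zero_le) ?_
  filter_upwards [eventually_le_log 1,
    eventually_mul_log_le_choose (2 * ((4 : ℝ) ^ d * (k + 1) + 1)) 1 d hd,
    eventually_ge_atTop (2 * d + 2 * k)] with n hL hch hn
  have hn0 : (0 : ℝ) < n := by exact_mod_cast (by omega)
  have hd1 : (1 : ℝ) ≤ d := by exact_mod_cast (by omega)
  have hup := upperTime_le (d := d) (k := k) (by omega : 1 ≤ n) hL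
  have hm : 2 * upperTime n d k ≤ n.choose d := by
    have h1 : ((n - 2).choose d : ℝ) ≤ n.choose d := by
      exact_mod_cast Nat.choose_le_choose d (Nat.sub_le n 2)
    have : 2 * (upperTime n d k : ℝ) ≤ n.choose d := by
      rw [pow_one] at hch; linarith
    exact_mod_cast this
  refine (processLaw_lowDegreeEvent_le (by omega) hk (by omega) hm).trans
    (ENNReal.ofReal_le_ofReal ?_)
  have hratio := choose_ratio_ge (n := n) (d := d) (b := k) (by omega) (by omega)
  rw [show n - 1 - (k - 1) = n - k by omega]
  set y : ℝ := ((n - k).choose (d - 1) : ℝ) / n.choose d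
  have hρ : (1 / 4 : ℝ) ≤ ((n : ℝ) - k - d) / n := by
    rw [le_div_iff₀ hn0]
    have : ((2 * k + 2 * d : ℕ) : ℝ) ≤ n := by exact_mod_cast (by omega)
    push_cast at this
    linarith
  have hy : (1 : ℝ) / n * (1 / 4) ^ (d - 1) ≤ y := by
    refine le_trans ?_ hratio
    gcongr
  have hprod : ((k : ℝ) + 1) * Real.log n ≤ y * upperTime n d k := by
    calc ((k : ℝ) + 1) * Real.log n ≤ 4 * (((k : ℝ) + 1) * Real.log n) := by
          have : 0 ≤ ((k : ℝ) + 1) * Real.log n := by positivity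
          linarith
      _ = (1 / n * (1 / 4) ^ (d - 1)) * ((4 : ℝ) ^ d * (k + 1) * (n * Real.log n)) := by
          obtain ⟨e, rfl⟩ : ∃ e, d = e + 1 := ⟨d - 1, by omega⟩
          rw [Nat.add_sub_cancel, pow_succ, one_div_pow]
          field_simp
      _ ≤ y * upperTime n d k := by
          gcongr
          exact le_upperTime n d k
  calc (n : ℝ) ^ k * Real.exp (-y * upperTime n d k)
      ≤ (n : ℝ) ^ k * Real.exp (-(((k + 1 : ℕ) : ℝ) * Real.log n)) := by
        gcongr
        push_cast
        linarith
    _ = 1 / n := by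
        rw [Real.exp_neg, Real.exp_nat_mul, Real.exp_log hn0, pow_succ]
        field_simp

end RandomHypergraph

/-! ### Isolated vertices at the lower time, and the conclusion -/

namespace RandomHypergraph

/-- A lower bound for the expected number of isolated vertices at the lower time. -/
theorem expected_isolated_ge {n d : ℕ} (hd : 1 ≤ d) (hn : 1 ≤ n) (hL : 1 ≤ Real.log n)
    (h1 : 4 * ((n : ℝ) * Real.log n ^ 2) ≤ n.choose d) (h2 : 4 * d * Real.log n ≤ n) :
    √(Real.log n) / Real.exp 1 ≤ n * ∏ i ∈ Finset.range (lowerTime n d),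
        (1 - ((n.choose d : ℝ) - (n - 1).choose d) / ((n.choose d : ℝ) - i)) := by
  set L := Real.log n with hLdef
  set N : ℝ := (n.choose d : ℝ) with hN
  set m := lowerTime n d with hm
  set R : ℝ := L - Real.log L / 2 with hR
  have hn0 : (0 : ℝ) < n := by exact_mod_cast hn
  have hd1 : (1 : ℝ) ≤ d := by exact_mod_cast hd
  have hll0 : 0 ≤ Real.log L := Real.log_nonneg hL
  have hll : Real.log L ≤ L - 1 := Real.log_le_sub_one_of_pos (by linarith)
  have hR0 : 0 ≤ R := by simp only [hR]; linarith
  have hRL : R ≤ L := by simp only [hR]; linarith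
  have hNpos : 0 < N := lt_of_lt_of_le (by positivity) h1
  have hmle : (m : ℝ) ≤ n / d * R := lowerTime_le hL
  set D : ℝ := N - (n - 1).choose d with hD
  have hDeq : D = N * d / n := by
    have h := choose_mul_eq hn hd
    have hp : (n.choose d : ℝ) = (n - 1).choose (d - 1) + (n - 1).choose d := by
      obtain ⟨a, rfl⟩ := Nat.exists_eq_add_of_le' hn
      obtain ⟨b, rfl⟩ := Nat.exists_eq_add_of_le' hd
      exact_mod_cast Nat.choose_succ_succ' a b
    rw [eq_div_iff hn0.ne', ← h, hD, hN, hp]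
    ring
  have hD0 : 0 ≤ D := by rw [hDeq]; positivity
  have hmn : (m : ℝ) ≤ n * L :=
    hmle.trans (mul_le_mul (div_le_self hn0.le hd1) hRL hR0 hn0.le)
  -- This keeps `N / (N - m - D)` below `1 + 1 / L`. The exponent `R ≤ L` then grows by at most `1`,
  -- which accounts for the factor `Real.exp 1`.
  have hmD : (L + 1) * (m + D) ≤ N := by
    have h3 : (L + 1) * m ≤ N / 2 := by
      calc (L + 1) * m ≤ (2 * L) * (n * L) := by gcongr; linarith
        _ ≤ N / 2 := by linarith
    have h4 : (L + 1) * D ≤ N / 2 := by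
      rw [hDeq]
      calc (L + 1) * (N * d / n) ≤ (2 * L) * (N * d / n) := by gcongr; linarith
        _ = N * (4 * d * L) / n / 2 := by ring
        _ ≤ N * n / n / 2 := by gcongr
        _ = N / 2 := by field_simp
    linarith
  have hW : 0 < N - m - D := by nlinarith
  -- From `1 - x = (1 + x / (1 - x))⁻¹ ≥ exp (-x / (1 - x))` at `x = D / (N - m)`.
  have hfac : ∀ i ∈ Finset.range m, Real.exp (-(D / (N - m - D))) ≤ 1 - D / (N - i) := by
    intro i hi
    have him : (i : ℝ) ≤ m := by exact_mod_cast (Finset.mem_range.1 hi).le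
    have h5 : D / (N - i) ≤ D / (N - m) := by
      gcongr
      linarith
    have h6 : Real.exp (-(D / (N - m - D))) ≤ 1 - D / (N - m) := by
      have h7 : 1 - D / (N - m) = (1 + D / (N - m - D))⁻¹ := by
        have : N - m ≠ 0 := by linarith
        field_simp
        ring
      rw [h7, Real.exp_neg]
      gcongr
      linarith [Real.add_one_le_exp (D / (N - m - D))]
    linarith
  have hexp : m * (D / (N - m - D)) ≤ R + 1 := by
    have h8 : N / (N - m - D) ≤ 1 + 1 / L := by
      rw [div_le_iff₀ hW, one_add_div (by linarith), div_mul_eq_mul_div, le_div_iff₀ (by linarith)]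
      linarith
    calc m * (D / (N - m - D)) ≤ (n / d * R) * (D / (N - m - D)) := by gcongr
      _ = R * (N / (N - m - D)) := by rw [hDeq]; field_simp
      _ ≤ R * (1 + 1 / L) := by gcongr
      _ = R + R / L := by ring
      _ ≤ R + 1 := by gcongr; exact div_le_one_of_le₀ hRL (by linarith)
  calc √L / Real.exp 1 = n * Real.exp (-(R + 1)) := by
        rw [show -(R + 1) = Real.log L / 2 - 1 - L by simp only [hR]; ring, Real.exp_sub,
          Real.exp_sub, hLdef, Real.exp_log hn0, Real.exp_half, Real.exp_log (by linarith)]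
        field_simp
    _ ≤ n * Real.exp (m * -(D / (N - m - D))) := by
        gcongr
        linarith
    _ = n * ∏ i ∈ Finset.range m, Real.exp (-(D / (N - m - D))) := by
        rw [Finset.prod_const, Finset.card_range, Real.exp_nat_mul]
    _ ≤ _ := by
        gcongr with i hi
        exact hfac i hi

theorem toOuterMeasure_ne_top {Ω : Type*} (P : PMF Ω) (s : Set Ω) : P.toOuterMeasure s ≠ ⊤ := by
  rw [PMF.toOuterMeasure_apply]
  exact P.tsum_coe_indicator_ne_top s

theorem tendsto_no_isolated (d : ℕ) (hd : 3 ≤ d) :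
    Tendsto (fun n : ℕ => (processLaw n d).toOuterMeasure
      {ω | ∀ v, ω ∉ isolatedEvent n d (lowerTime n d) v}) atTop (𝓝 0) := by
  have hu : Tendsto (fun n : ℕ => √(Real.log n)) atTop atTop :=
    Real.tendsto_sqrt_atTop.comp
      (Real.tendsto_log_atTop.comp (tendsto_natCast_atTop_atTop (R := ℝ)))
  have hlim := ENNReal.tendsto_ofReal (hu.const_div_atTop (Real.exp 1))
  rw [ENNReal.ofReal_zero] at hlim
  refine tendsto_of_tendsto_of_tendsto_of_le_of_le' tendsto_const_nhds hlim
    (Eventually.of_forall fun n => zero_le) ?_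
  filter_upwards [eventually_le_log 1, eventually_mul_log_le_choose 4 2 d hd,
    eventually_mul_log_pow_le (4 * d) 1, eventually_ge_atTop 2] with n hL hch hdn hn
  have hd1 : (1 : ℝ) ≤ d := by exact_mod_cast (by omega)
  have hn0 : (0 : ℝ) < n := by exact_mod_cast (by omega)
  have hchn : ((n - 2).choose d : ℝ) ≤ n.choose d := by
    exact_mod_cast Nat.choose_le_choose d (Nat.sub_le n 2)
  have hm : lowerTime n d ≤ (n - 2).choose d := by
    have h1 := lowerTime_le (d := d) hL
    have hll0 : 0 ≤ Real.log (Real.log n) := Real.log_nonneg hL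
    have hll : Real.log (Real.log n) ≤ Real.log n - 1 :=
      Real.log_le_sub_one_of_pos (by linarith)
    have h2 : (n : ℝ) / d * (Real.log n - Real.log (Real.log n) / 2) ≤ n * Real.log n :=
      mul_le_mul (div_le_self hn0.le hd1) (by linarith) (by linarith) hn0.le
    have h3 : (n : ℝ) * Real.log n ≤ 4 * (n * Real.log n ^ 2) := by
      have : 0 ≤ (n : ℝ) * Real.log n := by positivity
      nlinarith
    have : (lowerTime n d : ℝ) ≤ (n - 2).choose d := by linarith
    exact_mod_cast this
  have h1 := processLaw_no_isolated_le hn (by omega) hm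
  have h2 := expected_isolated_ge (by omega : 1 ≤ d) (by omega : 1 ≤ n) hL (hch.trans hchn)
    (by simpa using hdn)
  rw [← ENNReal.ofReal_toReal (toOuterMeasure_ne_top (processLaw n d) _)]
  refine ENNReal.ofReal_le_ofReal ?_
  have hs : 0 < √(Real.log n) := Real.sqrt_pos.2 (by linarith)
  have h3 := (mul_le_mul_of_nonneg_left h2 ENNReal.toReal_nonneg).trans h1
  rw [le_div_iff₀ hs]
  rw [mul_div_assoc', div_le_one (by positivity)] at h3
  exact h3

theorem coe_untopA {x : WithTop ℕ} (hx : x ≠ ⊤) : WithTop.some x.untopA = x := by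
  obtain ⟨t, rfl⟩ := WithTop.ne_top_iff_exists.1 hx
  rfl

/-- If the minimum degree reaches `k` only after time `m₁` and before time `m₂`, and in this period
minimum degree `k` entails `k`-connectedness, then both are reached at the same time. -/
theorem minDegreeTime_eq_connectivityTime {n d k m₁ m₂ : ℕ} {ω : List (Finset (Fin n))}
    (hd : 2 ≤ d) (hk : 1 ≤ k) (hω : ∀ e ∈ ω, e.card = d)
    (hiso : ∃ v, ω ∈ isolatedEvent n d m₁ v) (hlow : ω ∉ lowDegreeEvent n d k m₂)
    (hgap : ω ∉ gapEvent n d k m₁ m₂) :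
    minDegreeTime n k ω = connectivityTime n k ω := by
  have hcard : ∀ t, ∀ e ∈ edgesAt n t ω, e.card = d := fun t e he =>
    hω e (List.mem_of_mem_take (mem_edgesAt.1 he))
  have hmin₂ : (process n m₂ ω).MinDegreeAtLeast k := by
    by_contra h
    exact hlow ⟨hω, h⟩
  -- A vertex isolated at `m₁` has degree `0 < k` at all earlier times.
  have hlate : ∀ t, (process n t ω).MinDegreeAtLeast k → m₁ ≤ t := by
    intro t ht
    by_contra! htm
    obtain ⟨v, hv⟩ := hiso
    have h1 := minDegreeAtLeast_process_iff.1 ht v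
    obtain ⟨e, he⟩ := Finset.card_pos.1 (by omega : 0 < ((edgesAt n t ω).filter (v ∈ ·)).card)
    rw [Finset.mem_filter] at he
    refine hv e ?_ (mem_edgesAt.1 (edgesAt_mono htm.le ω he.1))
    rw [edgesMeeting, Finset.mem_filter, mem_potentialEdges, Finset.disjoint_singleton_right,
      not_not]
    exact ⟨hcard t e he.1, he.2⟩
  apply le_antisymm
  · by_cases htop : connectivityTime n k ω = ⊤
    · rw [htop]; exact le_top
    have hmem : (process n (connectivityTime n k ω).untopA ω).KConnected k :=
      MeasureTheory.hittingAfter_mem_set_of_ne_top htop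
    have hle := MeasureTheory.hittingAfter_le_of_mem (u := process n)
      (s := {H | H.MinDegreeAtLeast k}) (Nat.zero_le _)
      (minDegreeAtLeast_of_kConnected (fun e he => (hcard _ e he).symm ▸ hd) hmem)
    rwa [coe_untopA htop] at hle
  · have hle₂ : minDegreeTime n k ω ≤ WithTop.some m₂ :=
      MeasureTheory.hittingAfter_le_of_mem (Nat.zero_le _) hmin₂
    have htop : minDegreeTime n k ω ≠ ⊤ := ne_top_of_le_ne_top (WithTop.coe_ne_top) hle₂
    have hmem : (process n (minDegreeTime n k ω).untopA ω).MinDegreeAtLeast k :=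
      MeasureTheory.hittingAfter_mem_set_of_ne_top htop
    have ht₂ : (minDegreeTime n k ω).untopA ≤ m₂ := by
      rw [← coe_untopA htop] at hle₂
      exact WithTop.coe_le_coe.1 hle₂
    have hcon : (process n (minDegreeTime n k ω).untopA ω).KConnected k := by
      by_contra h
      exact hgap ⟨hω, _, hlate _ hmem, ht₂, hmem, h⟩
    have hle := MeasureTheory.hittingAfter_le_of_mem (u := process n)
      (s := {H | H.KConnected k}) (Nat.zero_le _) hcon
    rwa [coe_untopA htop] at hle

end RandomHypergraph

open RandomHypergraph in
theorem theorem1p25 (d k : ℕ) (hd : 3 ≤ d) (hk : 1 ≤ k) :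
    Tendsto
      (fun n : ℕ => (RandomHypergraph.processLaw n d).toOuterMeasure
        {ω | RandomHypergraph.minDegreeTime n k ω = RandomHypergraph.connectivityTime n k ω})
      atTop (𝓝 1) := by
  have hbad := ((tendsto_no_isolated d hd).add (tendsto_lowDegreeEvent d k hd hk)).add
    (tendsto_gapEvent d k hd)
  rw [add_zero, add_zero] at hbad
  have hlow := ENNReal.Tendsto.sub (tendsto_const_nhds (x := (1 : ENNReal))) hbad
    (Or.inl ENNReal.one_ne_top)
  rw [tsub_zero] at hlow
  refine tendsto_of_tendsto_of_tendsto_of_le_of_le hlow tendsto_const_nhds (fun n => ?_)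
    (fun n => ?_)
  · rw [tsub_le_iff_right]
    -- Restricting to the support guarantees that every listed edge has `d` vertices, as the
    -- deterministic comparison requires.
    calc (1 : ENNReal) = (processLaw n d).toOuterMeasure (processLaw n d).support :=
          ((PMF.toOuterMeasure_apply_eq_one_iff _ _).2 subset_rfl).symm
      _ ≤ (processLaw n d).toOuterMeasure
          ({ω | minDegreeTime n k ω = connectivityTime n k ω} ∪
            (({ω | ∀ v, ω ∉ isolatedEvent n d (lowerTime n d) v} ∪
              lowDegreeEvent n d k (upperTime n d k)) ∪
              gapEvent n d k (lowerTime n d) (upperTime n d k))) := by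
          refine MeasureTheory.measure_mono fun ω hω => ?_
          have hadm := admissible_of_mem_support le_rfl hω
          by_contra h
          simp only [Set.mem_union, not_or] at h
          obtain ⟨h0, ⟨h1, h2⟩, h3⟩ := h
          refine h0 (minDegreeTime_eq_connectivityTime (by omega) hk
            (fun e he => mem_potentialEdges.1 (hadm.2.2 e he)) ?_ h2 h3)
          by_contra! hall
          exact h1 hall
      _ ≤ _ := (MeasureTheory.measure_union_le _ _).trans (by
          gcongr
          exact (MeasureTheory.measure_union_le _ _).trans (by
            gcongr
            exact MeasureTheory.measure_union_le _ _))
  · exact (MeasureTheory.measure_mono (Set.subset_univ _)).trans_eq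
      ((PMF.toOuterMeasure_apply_eq_one_iff _ _).2 (Set.subset_univ _))
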